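/- Let $z\in\mathbb{C}\setminus(-\infty,0]$. For $\mu\in\mathbb{C}$ let $\langle \mathrm{Re}\,\mu\rangle$ be the nearest integer to $\mathrm{Re}\,\mu$, with $\langle n+\tfrac12\rangle=n$ for $n\in\mathbb{Z}$, and $\{\mu\}=\mu-\langle \mathrm{Re}\,\mu\rangle$. Let $$J_\mu(z)=\Big(\frac z2\Big)^{\mu}\sum_{k\ge 0}\frac{(-1)^k(z/2)^{2k}}{k!\,\Gamma(\mu+k+1)},\qquad Y_\mu(z)=\frac{J_\mu(z)\cos\mu\pi-J_{-\mu}(z)}{\sin\mu\pi}\ (\mu\notin\mathbb{Z}),\qquad Y_m(z)=\lim_{\mu\to m}Y_\mu(z)\ (m\in\mathbb{Z}),$$ with $1/\Gamma=0$ at the poles of $\Gamma$. Let $P(\nu,w)=\gamma(\nu,w)/\Gamma(\nu)=w^{\nu}\gamma^*(\nu,w)$ be the normalised lower incomplete gamma function, where $\gamma^*(\nu,w)=\frac1{\Gamma(\nu)}\sum_{m\ge0}\frac{(-w)^m}{(\nu+m)\,m!}$ for $\nu\ne0,-1,-2,\dots$ and $\gamma^*(-n,w)=w^n$ for $n=0,1,2,\dots$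 (so $P(0,w)=1$). Put $i^a=e^{i\pi a/2}$; powers $z^a$ are principal, and powers of $-iz$ (also inside $P$) are taken with $\arg(-iz)=\arg z-\pi/2$, $-\pi<\arg z<\pi$, i.e. in the branch analytic for $z\in\mathbb{C}\setminus(-\infty,0]$. Define $$B_\mu(z)=\frac{i^\mu}{\pi}\int_0^\pi e^{-iz\cos\theta}\,P(\{\mu\},-iz(1+\cos\theta))\cos\mu\theta\,d\theta ,$$ $$\chi_\mu(z)=\frac{i^\mu}{\sqrt\pi}\,e^{iz}\sum_{j=1}^{-\langle \mathrm{Re}\,\mu\rangle}\frac{\Gamma(j+\mu-\frac12)}{\Gamma(j)\,\Gamma(j+2\mu)}(-2iz)^{j+\mu-1}\ \text{ if } \mathrm{Re}\,\mu\le-\tfrac12,\qquad \chi_\mu(z)=0\ \text{ if } \mathrm{Re}\,\mu>-\tfrac12,$$ where each quotient $\Gamma(j+\mu-\frac12)/\Gamma(j+2\mu)$ is understood as its limit, as the order tends to $\mu$, when $\mu$ is a negative half-integer; let $S(\mu)=\cos\mu\pi$ if $\mathrm{Re}\,\mu<0$, $S(\mu)=-1$ if $\mathrm{Re}\,\mu\ge0$,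 and, for $\mu\notin\mathbb{Z}$, $$\mathcal{Y}_\mu(z)=\frac{B_\mu(z)\cos\mu\pi-B_{-\mu}(z)}{\sin\mu\pi}.$$ Then: 1. The integral defining $B_\mu(z)$ converges absolutely for every $\mu\in\mathbb{C}$. 2. For every $\mu\in\mathbb{C}\setminus\mathbb{Z}$, $$Y_\mu(z)=\mathcal{Y}_\mu(z)+S(\mu)\,\frac{\chi_{-\mu\,\mathrm{sgn}(\mathrm{Re}\,\mu)}(z)}{\sin\mu\pi},$$ $$\mathcal{Y}_\mu(z)=\frac{i^\mu}{\pi\sin\mu\pi}\int_0^\pi e^{-iz\cos\theta}\Big[\cos\mu\pi\,P(\{\mu\},-iz(1+\cos\theta))-e^{-i\mu\pi}P(\{-\mu\},-iz(1+\cos\theta))\Big]\cos\mu\theta\,d\theta ,$$ and here $\{-\mu\}$ may be replaced by $-\{\mu\}$ if $\mathrm{Re}\{\mu\}\ne\frac12$. 3. For $m\in\mathbb{Z}$ the representation holds in the limit: as $\mu\to m$, both $\mathcal{Y}_\mu(z)$ and $S(\mu)\chi_{-\mu\,\mathrm{sgn}(\mathrm{Re}\,\mu)}(z)/\sin\mu\pi$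 have finite limits, $Y_\mu(z)$ tends to $Y_m(z)$, and $Y_m(z)$ is the sum of these two limits. -/

import Mathlib

open Filter Topology

noncomputable section

/-- The nearest integer `⟨x⟩`, with the convention `⟨n + 1/2⟩ = n`. -/
def nearestInt (x : ℝ) : ℤ := ⌈x - 1 / 2⌉

/-- The complex fractional part `{μ} = μ - ⟨Re μ⟩`, so that `-1/2 < Re {μ} ≤ 1/2`. -/
def cfract (μ : ℂ) : ℂ := μ - (nearestInt μ.re : ℂ)

/-- The Bessel function of the first kind `J_μ(z)`. -/
def besselJ (μ z : ℂ) : ℂ :=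
  (z / 2) ^ μ *
    ∑' k : ℕ, (-1) ^ k * (z / 2) ^ (2 * k) / ((k.factorial : ℂ) * Complex.Gamma (μ + k + 1))

/-- The quotient defining `Y_μ(z)` when `μ` is not an integer. -/
def besselYQuot (μ z : ℂ) : ℂ :=
  (besselJ μ z * Complex.cos (μ * Real.pi) - besselJ (-μ) z) / Complex.sin (μ * Real.pi)

open Classical in
/-- The Bessel function of the second kind `Y_μ(z)`; at integer order it is the limit of the
quotient. -/
def besselY (μ z : ℂ) : ℂ :=
  if ∃ m : ℤ, μ = m then limUnder (𝓝[≠] μ) (fun ν => besselYQuot ν z) else besselYQuot μ z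

open Classical in
/-- Tricomi's entire function `γ*(ν, w) = w ^ (-ν) γ(ν, w) / Γ(ν)`, where
`γ(ν, w) = w ^ ν ∑ₘ (-w) ^ m / ((ν + m) m!)` is the lower incomplete gamma function; at
`ν = -n` with `n = 0, 1, 2, …` its value is `w ^ n`. -/
def gammaStar (ν w : ℂ) : ℂ :=
  if ∃ n : ℕ, ν = -(n : ℂ) then w ^ (-ν)
  else (Complex.Gamma ν)⁻¹ * ∑' m : ℕ, (-w) ^ m / ((ν + m) * (m.factorial : ℂ))

/-- The power `(-i z t) ^ a` for `t ≥ 0`, in the branch which is analytic in `z` on the plane slit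
along `(-∞, 0]`: `arg (-i z)` is taken to be `arg z - π / 2`. -/
def negIPow (z : ℂ) (t : ℝ) (a : ℂ) : ℂ :=
  Complex.exp (a * (Complex.log z - Complex.I * (Real.pi / 2))) * (t : ℂ) ^ a

/-- For `-π/2 < arg z` the branch above is the principal one. -/
theorem negIPow_eq_cpow {z : ℂ} (hz : z ≠ 0) (hz' : -(Real.pi / 2) < z.arg) {t : ℝ} (ht : 0 < t)
    (a : ℂ) : negIPow z t a = (-Complex.I * z * t) ^ a := by
  have h0 : (-Complex.I * z) ≠ 0 := mul_ne_zero (neg_ne_zero.2 Complex.I_ne_zero) hz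
  have hlog : Complex.log (-Complex.I * z) = Complex.log z - Complex.I * (Real.pi / 2) := by
    rw [Complex.log_mul (neg_ne_zero.2 Complex.I_ne_zero) hz, Complex.log_neg_I]
    · ring
    · rw [Complex.arg_neg_I]
      constructor
      · linarith
      · have := Complex.arg_le_pi z
        linarith [Real.pi_pos]
  have ht' : (t : ℂ) ≠ 0 := Complex.ofReal_ne_zero.2 ht.ne'
  rw [negIPow, Complex.cpow_def_of_ne_zero ht', Complex.cpow_def_of_ne_zero (mul_ne_zero h0 ht'),
    Complex.log_mul_ofReal t ht _ h0, hlog, ← Complex.ofReal_log ht.le, ← Complex.exp_add]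
  ring_nf

/-- The normalised incomplete gamma function `P(ν, w) = γ(ν, w) / Γ(ν) = w ^ ν γ*(ν, w)` at
`w = -i z t`, `t ≥ 0`, the power being taken in the branch `negIPow`. -/
def incGammaP (ν z : ℂ) (t : ℝ) : ℂ :=
  negIPow z t ν * gammaStar ν (-Complex.I * z * t)

/-- The integrand of the integral part of `J_μ(z)`. -/
def integrandB (μ z : ℂ) (θ : ℝ) : ℂ :=
  Complex.exp (-Complex.I * z * Real.cos θ) * incGammaP (cfract μ) z (1 + Real.cos θ) *
    Complex.cos (μ * θ)

/-- The integral part `B_μ(z)` of `J_μ(z)`. -/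
def integralB (μ z : ℂ) : ℂ :=
  Complex.I ^ μ / Real.pi * ∫ θ in (0 : ℝ)..Real.pi, integrandB μ z θ

/-- The quotient `Γ(j + μ - 1/2) / Γ(j + 2μ)`, understood in the limiting form, which matters when
`μ` is a negative half-integer. -/
def gammaRatio (j : ℕ) (μ : ℂ) : ℂ :=
  limUnder (𝓝[≠] μ) (fun ν => Complex.Gamma (j + ν - 1 / 2) / Complex.Gamma (j + 2 * ν))

/-- The corrective sum `χ_μ(z)`. -/
def corrective (μ z : ℂ) : ℂ :=
  if μ.re ≤ -(1 / 2) then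
    Complex.I ^ μ / (Real.sqrt Real.pi : ℂ) * Complex.exp (Complex.I * z) *
      ∑ j ∈ Finset.Icc 1 (-nearestInt μ.re).toNat,
        gammaRatio j μ / Complex.Gamma j * negIPow z 2 (j + μ - 1)
  else 0

/-- The sign factor `S(μ)`. -/
def factorS (μ : ℂ) : ℂ := if μ.re < 0 then Complex.cos (μ * Real.pi) else -1

/-- The integral part `𝒴_μ(z)` of `Y_μ(z)`. -/
def integralY (μ z : ℂ) : ℂ :=
  (integralB μ z * Complex.cos (μ * Real.pi) - integralB (-μ) z) / Complex.sin (μ * Real.pi)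

/-- The integrand of `𝒴_μ(z)` in its explicit form, where `ν` stands for the first argument of the
second incomplete gamma function. -/
def integrandY (μ ν z : ℂ) (θ : ℝ) : ℂ :=
  Complex.exp (-Complex.I * z * Real.cos θ) *
    (Complex.cos (μ * Real.pi) * incGammaP (cfract μ) z (1 + Real.cos θ) -
      Complex.exp (-Complex.I * μ * Real.pi) * incGammaP ν z (1 + Real.cos θ)) *
    Complex.cos (μ * θ)

/-- Away from the poles of the numerator the limiting form is the plain quotient. -/
theorem gammaRatio_eq {j : ℕ} {μ : ℂ} (h : ∀ n : ℕ, (j : ℂ) + μ - 1 / 2 ≠ -n) :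
    gammaRatio j μ = Complex.Gamma (j + μ - 1 / 2) / Complex.Gamma (j + 2 * μ) := by
  have h1 : ContinuousAt (fun ν : ℂ => Complex.Gamma (j + ν - 1 / 2)) μ :=
    ContinuousAt.comp (f := fun ν : ℂ => (j : ℂ) + ν - 1 / 2)
      (Complex.differentiableAt_Gamma _ h).continuousAt (by fun_prop)
  have h2 : ContinuousAt (fun ν : ℂ => (Complex.Gamma (j + 2 * ν))⁻¹) μ :=
    (Complex.differentiable_one_div_Gamma.continuous.comp
      (g := fun s : ℂ => (Complex.Gamma s)⁻¹) (f := fun ν : ℂ => (j : ℂ) + 2 * ν)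
      (by fun_prop)).continuousAt
  refine Tendsto.limUnder_eq ?_
  simp only [div_eq_mul_inv] at h1 ⊢
  exact (h1.mul h2).tendsto.mono_left nhdsWithin_le_nhds

/-- The value of the limiting form at the negative half-integer `m + 1/2`. -/
theorem gammaRatio_half {j : ℕ} {m : ℤ} (hj : 1 ≤ j) (hjm : (j : ℤ) ≤ -m) :
    gammaRatio j (m + 1 / 2) =
      2 * (-1) ^ (m + 1) * Complex.Gamma (-j - 2 * m) / Complex.Gamma (-j - m + 1) := by
  have hjr : (1 : ℝ) ≤ j := by exact_mod_cast hj
  have hmr : (j : ℝ) ≤ -(m : ℝ) := by exact_mod_cast hjm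
  set μ : ℂ := m + 1 / 2 with hμ
  have hre : μ.re = m + 1 / 2 := by simp [hμ]
  have hc1 : ContinuousAt (fun ν : ℂ => Complex.Gamma (1 - (j + 2 * ν))) μ :=
    ContinuousAt.comp (f := fun ν : ℂ => 1 - ((j : ℂ) + 2 * ν))
      (Complex.differentiableAt_Gamma _ (fun n h => by
        have := congrArg Complex.re h
        simp [hre] at this
        have hn : (0 : ℝ) ≤ n := n.cast_nonneg
        linarith)).continuousAt (by fun_prop)
  have hc2 : ContinuousAt (fun ν : ℂ => (Complex.Gamma (1 - (j + ν - 1 / 2)))⁻¹) μ :=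
    (Complex.differentiable_one_div_Gamma.continuous.comp
      (g := fun s : ℂ => (Complex.Gamma s)⁻¹) (f := fun ν : ℂ => 1 - ((j : ℂ) + ν - 1 / 2))
      (by fun_prop)).continuousAt
  have hlim : Tendsto (fun ν : ℂ => -2 * Complex.sin (Real.pi * ν) *
      (Complex.Gamma (1 - (j + 2 * ν)) * (Complex.Gamma (1 - (j + ν - 1 / 2)))⁻¹)) (𝓝[≠] μ)
      (𝓝 (-2 * Complex.sin (Real.pi * μ) *
        (Complex.Gamma (1 - (j + 2 * μ)) * (Complex.Gamma (1 - (j + μ - 1 / 2)))⁻¹))) := by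
    have hs : ContinuousAt (fun ν : ℂ => -2 * Complex.sin (Real.pi * ν)) μ := by fun_prop
    exact (hs.mul (hc1.mul hc2)).tendsto.mono_left nhdsWithin_le_nhds
  have hsin : Complex.sin (Real.pi * μ) = (-1) ^ m := by
    rw [hμ, show (Real.pi : ℂ) * (m + 1 / 2) = Real.pi / 2 + m * Real.pi by ring,
      Complex.sin_antiperiodic.add_int_mul_eq, Complex.sin_pi_div_two, mul_one,
      Int.cast_negOnePow]
  refine Tendsto.limUnder_eq ?_
  have hval : -2 * Complex.sin (Real.pi * μ) *
        (Complex.Gamma (1 - (j + 2 * μ)) * (Complex.Gamma (1 - (j + μ - 1 / 2)))⁻¹) =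
      2 * (-1) ^ (m + 1) * Complex.Gamma (-j - 2 * m) / Complex.Gamma (-j - m + 1) := by
    rw [hsin, zpow_add_one₀ (by norm_num : (-1 : ℂ) ≠ 0), hμ,
      show (1 : ℂ) - (j + 2 * (m + 1 / 2)) = -j - 2 * m by ring,
      show (1 : ℂ) - (j + (m + 1 / 2) - 1 / 2) = -j - m + 1 by ring]
    ring
  rw [← hval]
  refine hlim.congr' ?_
  have hball : ∀ᶠ ν in 𝓝 μ, ‖ν - μ‖ < 1 / 4 := by
    filter_upwards [Metric.ball_mem_nhds μ (by norm_num : (0 : ℝ) < 1 / 4)] with ν hν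
    rwa [Metric.mem_ball, dist_eq_norm] at hν
  filter_upwards [nhdsWithin_le_nhds hball, self_mem_nhdsWithin] with ν hν hne
  have hd : |ν.re - μ.re| < 1 / 4 := by
    simpa using (Complex.abs_re_le_norm (ν - μ)).trans_lt hν
  rw [abs_lt, hre] at hd
  have hcos : Complex.cos (Real.pi * ν) ≠ 0 := by
    intro h0
    obtain ⟨k, hk⟩ := Complex.cos_eq_zero_iff.1 h0
    have hpi : (Real.pi : ℂ) ≠ 0 := Complex.ofReal_ne_zero.2 Real.pi_ne_zero
    have hk' : ν = k + 1 / 2 := by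
      apply mul_left_cancel₀ hpi
      rw [hk]; ring
    have hkr : ν.re = k + 1 / 2 := by simp [hk']
    rw [hkr] at hd
    have h1 : ((k - m : ℤ) : ℝ) < 1 := by push_cast; linarith [hd.2]
    have h2 : (-1 : ℝ) < ((k - m : ℤ) : ℝ) := by push_cast; linarith [hd.1]
    have h3 : k = m := by
      have h1' : k - m < 1 := by exact_mod_cast h1
      have h2' : -1 < k - m := by exact_mod_cast h2
      omega
    exact hne (by simp [hk', h3, hμ])
  have g1 : Complex.Gamma (1 - (j + 2 * ν)) ≠ 0 := Complex.Gamma_ne_zero_of_re_pos (by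
    simp; linarith [hd.2])
  have g2 : Complex.Gamma (1 - (j + ν - 1 / 2)) ≠ 0 := Complex.Gamma_ne_zero_of_re_pos (by
    simp; linarith [hd.2])
  have r1 := Complex.Gamma_mul_Gamma_one_sub (j + ν - 1 / 2)
  have r2 := Complex.Gamma_mul_Gamma_one_sub (j + 2 * ν)
  have s1 : Complex.sin (Real.pi * (j + ν - 1 / 2)) = -((-1) ^ j * Complex.cos (Real.pi * ν)) := by
    rw [show (Real.pi : ℂ) * (j + ν - 1 / 2) = (Real.pi * ν - Real.pi / 2) + j * Real.pi by ring,
      Complex.sin_antiperiodic.add_nat_mul_eq, Complex.sin_sub_pi_div_two]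
    ring
  have s2 : Complex.sin (Real.pi * (j + 2 * ν)) =
      (-1) ^ j * (2 * Complex.sin (Real.pi * ν) * Complex.cos (Real.pi * ν)) := by
    rw [show (Real.pi : ℂ) * (j + 2 * ν) = 2 * (Real.pi * ν) + j * Real.pi by ring,
      Complex.sin_antiperiodic.add_nat_mul_eq, Complex.sin_two_mul]
  rw [s1] at r1
  rw [s2] at r2
  have hpi : (Real.pi : ℂ) ≠ 0 := Complex.ofReal_ne_zero.2 Real.pi_ne_zero
  have hm1 : ((-1 : ℂ)) ^ j ≠ 0 := pow_ne_zero _ (by norm_num)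
  rw [eq_div_of_mul_eq g2 r1, eq_div_of_mul_eq g1 r2]
  by_cases hs0 : Complex.sin (Real.pi * ν) = 0
  · simp [hs0]
  · field_simp

end

noncomputable section

/-! The heart of the matter is `besselJ_eq_integralB_add_corrective`: J_μ = B_μ + χ_μ, obtained by
expanding both sides in the same series.

On the one side, splitting e^{iz} off the Bessel series gives Kummer's form J_μ(z) = (z/2)^μ e^{iz}
Σ_k c_k(μ) (-iz/2)^k with c_k = (2μ+k+1)_k / (k! Γ(μ+k+1)) (`besselJ_eq_kummer`).

On the other side put ν = {μ}, n = ⟨Re μ⟩ and w = -iz(1+cos θ). Since -iz cos θ = iz + w and e^w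
γ*(ν,w) = Σ_m w^m / Γ(ν+m+1), the integral B_μ can be computed term by term. Each term is a Cauchy
integral of (1+cos θ)^{ν+m} cos μθ, that is, up to a factor, the Fourier coefficient of
(1+e^{iφ})^{2(ν+m)} with the integer index m-n. It vanishes for m < n and is a binomial coefficient
otherwise, which turns the m-th term into the Kummer term of index k = m-n (`integral_term`). As m ≥
0, all k ≥ max(0,-n) occur. If n < 0, the terms with k < -n are missing; by the duplication formula
they add up to χ_μ (`corrective_eq`).

The formula for Y_μ is then algebra, because at most one of χ_μ and χ_{-μ} is nonzero. At an integer
m, the numerator of Y_μ and that of the corrective quotient agree near m with differentiable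
functions vanishing at m, while sin μπ has a simple zero there; so both quotients converge, and 𝒴_μ
converges as their difference. -/

/-! ### Power series -/

/-- The value of the product of two absolutely convergent power series. -/
theorem PowerSeries.hasSum_coeff_mul {f g : PowerSeries ℂ} {x : ℂ}
    (hf : Summable fun n => ‖PowerSeries.coeff n f * x ^ n‖)
    (hg : Summable fun n => ‖PowerSeries.coeff n g * x ^ n‖) :
    (Summable fun n => ‖PowerSeries.coeff n (f * g) * x ^ n‖) ∧
      ∑' n, PowerSeries.coeff n (f * g) * x ^ n =
        (∑' n, PowerSeries.coeff n f * x ^ n) * ∑' n, PowerSeries.coeff n g * x ^ n := by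
  have key : ∀ n, PowerSeries.coeff n (f * g) * x ^ n =
      ∑ kl ∈ Finset.HasAntidiagonal.antidiagonal n, (PowerSeries.coeff kl.1 f * x ^ kl.1) *
        (PowerSeries.coeff kl.2 g * x ^ kl.2) := by
    intro n
    rw [PowerSeries.coeff_mul, Finset.sum_mul]
    refine Finset.sum_congr rfl fun kl hkl => ?_
    rw [← Finset.HasAntidiagonal.mem_antidiagonal.1 hkl, pow_add]
    ring
  have h1 := summable_norm_sum_mul_antidiagonal_of_summable_norm hf hg
  have h2 := tsum_mul_tsum_eq_tsum_sum_antidiagonal_of_summable_norm hf hg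
  refine ⟨h1.congr fun n => by rw [key], ?_⟩
  rw [h2]
  exact tsum_congr key

/-- The power series of `exp (c x)`. -/
def expSeries (c : ℂ) : PowerSeries ℂ := PowerSeries.mk fun n => c ^ n / (n.factorial : ℂ)

theorem derivative_expSeries (c : ℂ) :
    PowerSeries.derivative ℂ (expSeries c) = PowerSeries.C c * expSeries c := by
  ext n
  rw [PowerSeries.coeff_derivative, PowerSeries.coeff_C_mul]
  simp only [expSeries, PowerSeries.coeff_mk]
  have h1 : (n.factorial : ℂ) ≠ 0 := by exact_mod_cast n.factorial_ne_zero
  have h2 : (n : ℂ) + 1 ≠ 0 := by exact_mod_cast n.succ_ne_zero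
  rw [Nat.factorial_succ]
  push_cast
  field_simp
  ring

theorem expSeries_term (c x : ℂ) (n : ℕ) :
    PowerSeries.coeff n (expSeries c) * x ^ n = (c * x) ^ n / (n.factorial : ℂ) := by
  rw [expSeries, PowerSeries.coeff_mk, mul_pow]
  ring

theorem summable_expSeries (c x : ℂ) :
    Summable fun n => ‖PowerSeries.coeff n (expSeries c) * x ^ n‖ := by
  simp only [expSeries_term]
  exact NormedSpace.norm_expSeries_div_summable (c * x)

theorem tsum_expSeries (c x : ℂ) :
    ∑' n, PowerSeries.coeff n (expSeries c) * x ^ n = Complex.exp (c * x) := by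
  simp only [expSeries_term]
  rw [Complex.exp_eq_exp_ℂ]
  exact (NormedSpace.expSeries_div_hasSum_exp (c * x)).tsum_eq

/-! ### The reciprocal Gamma function -/

/-- For k ≥ R the factor μ+k+1 has modulus at least 1, so passing from k to k+1 cannot increase the
modulus of 1/Γ(μ+k+1); the finitely many smaller k are covered by compactness. Uniformity in μ is
what later makes J_μ holomorphic in the order. -/
theorem exists_norm_inv_Gamma_le (R : ℕ) :
    ∃ C : ℝ, 0 ≤ C ∧ ∀ μ : ℂ, ‖μ‖ ≤ R → ∀ k : ℕ, ‖(Complex.Gamma (μ + k + 1))⁻¹‖ ≤ C := by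
  have hk : ∀ k : ℕ, ∃ C : ℝ, ∀ μ ∈ Metric.closedBall (0 : ℂ) R,
      ‖(Complex.Gamma (μ + k + 1))⁻¹‖ ≤ C := fun k =>
    (isCompact_closedBall (0 : ℂ) (R : ℝ)).exists_bound_of_continuousOn
      (Continuous.continuousOn (Complex.differentiable_one_div_Gamma.continuous.comp
        (g := fun s : ℂ => (Complex.Gamma s)⁻¹) (f := fun μ : ℂ => μ + k + 1) (by fun_prop)))
  choose C hC using hk
  refine ⟨∑ k ∈ Finset.range (R + 1), |C k|, Finset.sum_nonneg fun _ _ => abs_nonneg _, ?_⟩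
  intro μ hμ k
  have hsmall : ∀ k ≤ R, ‖(Complex.Gamma (μ + k + 1))⁻¹‖ ≤ ∑ k ∈ Finset.range (R + 1), |C k| :=
    fun k hkR => ((hC k μ (by simpa using hμ)).trans (le_abs_self _)).trans
      (Finset.single_le_sum (f := fun k => |C k|) (fun _ _ => abs_nonneg _)
        (Finset.mem_range.2 (by omega)))
  rcases le_total k R with h | h
  · exact hsmall k h
  · induction k, h using Nat.le_induction with
    | base => exact hsmall R le_rfl
    | succ k hk ih =>
      refine le_trans ?_ ih
      rw [Complex.one_div_Gamma_eq_self_mul_one_div_Gamma_add_one (μ + k + 1), norm_mul]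
      have h1 : 1 ≤ ‖μ + k + 1‖ := by
        have h2 : ‖((k : ℂ) + 1)‖ ≤ ‖μ + k + 1‖ + ‖μ‖ := by
          have := norm_sub_le (μ + k + 1) μ
          rwa [show μ + k + 1 - μ = (k : ℂ) + 1 by ring] at this
        have h3 : ‖((k : ℂ) + 1)‖ = k + 1 := by
          have : ‖((k + 1 : ℕ) : ℂ)‖ = ((k + 1 : ℕ) : ℝ) := Complex.norm_natCast _
          exact_mod_cast this
        have h4 : (R : ℝ) ≤ k := by exact_mod_cast hk
        linarith
      rw [show (μ + ((k + 1 : ℕ) : ℂ) + 1) = μ + k + 1 + 1 by push_cast; ring]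
      exact le_mul_of_one_le_left (norm_nonneg _) h1

theorem exists_norm_inv_Gamma_le_of_point (μ : ℂ) :
    ∃ C : ℝ, 0 ≤ C ∧ ∀ k : ℕ, ‖(Complex.Gamma (μ + k + 1))⁻¹‖ ≤ C := by
  obtain ⟨R, hR⟩ := exists_nat_ge ‖μ‖
  obtain ⟨C, hC, h⟩ := exists_norm_inv_Gamma_le R
  exact ⟨C, hC, h μ hR⟩

/-! ### The Kummer form of the Bessel series -/

/-- The coefficients of the series for `J_μ(z)` in the variable `-i z / 2` after the factor
`e ^ (i z)` has been split off. -/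
def kummerCoeff (μ : ℂ) (k : ℕ) : ℂ :=
  (∏ i ∈ Finset.range k, (2 * μ + k + 1 + i)) / (k.factorial : ℂ) *
    (Complex.Gamma (μ + k + 1))⁻¹

/-- The even power series `∑ x ^ (2 k) / (k! Γ(μ + k + 1))`. -/
def besselSeries (μ : ℂ) : PowerSeries ℂ := PowerSeries.mk fun n =>
  if Even n then (((n / 2).factorial : ℂ))⁻¹ * (Complex.Gamma (μ + (n / 2 : ℕ) + 1))⁻¹ else 0

theorem coeff_besselSeries_even (μ : ℂ) (k : ℕ) : PowerSeries.coeff (2 * k) (besselSeries μ) =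
    ((k.factorial : ℂ))⁻¹ * (Complex.Gamma (μ + k + 1))⁻¹ := by
  simp [besselSeries]

theorem coeff_besselSeries_odd (μ : ℂ) (k : ℕ) :
    PowerSeries.coeff (2 * k + 1) (besselSeries μ) = 0 := by
  simp [besselSeries, parity_simps]

theorem derivative_besselSeries (μ : ℂ) : PowerSeries.derivative ℂ (besselSeries μ) =
    PowerSeries.C 2 * (PowerSeries.X * besselSeries (μ + 1)) := by
  ext n
  rw [PowerSeries.coeff_derivative, PowerSeries.coeff_C_mul]
  rcases Nat.even_or_odd' n with ⟨k, rfl | rfl⟩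
  · rw [coeff_besselSeries_odd]
    rcases k with _ | k
    · simp
    · rw [show 2 * (k + 1) = 2 * k + 1 + 1 by ring, PowerSeries.coeff_succ_X_mul,
        coeff_besselSeries_odd]
      ring
  · rw [show 2 * k + 1 + 1 = 2 * (k + 1) by ring, coeff_besselSeries_even,
      PowerSeries.coeff_succ_X_mul, coeff_besselSeries_even]
    have h1 : (k.factorial : ℂ) ≠ 0 := by exact_mod_cast k.factorial_ne_zero
    have h2 : (k : ℂ) + 1 ≠ 0 := by exact_mod_cast k.succ_ne_zero
    rw [Nat.factorial_succ, show μ + 1 + k + 1 = μ + ((k + 1 : ℕ) : ℂ) + 1 by push_cast; ring]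
    generalize (Complex.Gamma (μ + ((k + 1 : ℕ) : ℂ) + 1))⁻¹ = g
    push_cast
    field_simp
    ring

theorem kummerCoeff_one (μ : ℂ) : kummerCoeff μ 1 = 2 * kummerCoeff μ 0 := by
  have h := Complex.one_div_Gamma_eq_self_mul_one_div_Gamma_add_one (μ + 1)
  simp only [kummerCoeff, Finset.prod_range_one, Finset.prod_range_zero, Nat.factorial_zero,
    Nat.factorial_one, Nat.cast_one, Nat.cast_zero, add_zero]
  rw [h]
  ring

/-- This is the recurrence forced by the differential equation of e^{2x} Σ x^{2k}/(k! Γ(μ+k+1)),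
where differentiation brings in the order μ+1. -/
theorem kummerCoeff_add_two (μ : ℂ) (n : ℕ) : ((n : ℂ) + 2) * kummerCoeff μ (n + 2) =
    2 * kummerCoeff μ (n + 1) + 2 * kummerCoeff (μ + 1) n := by
  have h := Complex.one_div_Gamma_eq_self_mul_one_div_Gamma_add_one (μ + n + 2)
  have h1 : (n.factorial : ℂ) ≠ 0 := by exact_mod_cast n.factorial_ne_zero
  have h2 : (n : ℂ) + 1 ≠ 0 := by exact_mod_cast n.succ_ne_zero
  have h3 : (n : ℂ) + 2 ≠ 0 := by exact_mod_cast (n + 1).succ_ne_zero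
  simp only [kummerCoeff]
  -- Peeling two last factors from one product and the first factor from another leaves the common
  -- product of 2μ+n+3+i over i < n.
  rw [Finset.prod_range_succ, Finset.prod_range_succ, Finset.prod_range_succ' _ n]
  have e1 : ∀ i : ℕ, 2 * μ + ((n + 1 : ℕ) : ℂ) + 1 + ((i + 1 : ℕ) : ℂ) = 2 * μ + n + 3 + i := by
    intro i; push_cast; ring
  have e2 : ∀ i : ℕ, 2 * μ + ((n + 2 : ℕ) : ℂ) + 1 + (i : ℂ) = 2 * μ + n + 3 + i := by
    intro i; push_cast; ring
  have e3 : ∀ i : ℕ, 2 * (μ + 1) + (n : ℂ) + 1 + (i : ℂ) = 2 * μ + n + 3 + i := by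
    intro i; ring
  simp only [e1, e2, e3]
  rw [show μ + ((n + 1 : ℕ) : ℂ) + 1 = μ + n + 2 by push_cast; ring,
    show μ + 1 + (n : ℂ) + 1 = μ + n + 2 by ring,
    show μ + ((n + 2 : ℕ) : ℂ) + 1 = μ + n + 2 + 1 by push_cast; ring, h,
    Nat.factorial_succ, Nat.factorial_succ]
  generalize (Complex.Gamma (μ + n + 2 + 1))⁻¹ = g
  push_cast
  rw [show (n : ℂ) + 1 + 1 = n + 2 by ring]
  field_simp
  ring

/-- Kummer's second formula on the level of formal series: both sides satisfy the same first-order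
recurrence and have the same constant term. -/
theorem expSeries_mul_besselSeries (μ : ℂ) :
    expSeries 2 * besselSeries μ = PowerSeries.mk (kummerCoeff μ) := by
  have hd : ∀ μ : ℂ, PowerSeries.derivative ℂ (expSeries 2 * besselSeries μ) =
      PowerSeries.C 2 * (expSeries 2 * besselSeries μ) +
        PowerSeries.C 2 * (PowerSeries.X * (expSeries 2 * besselSeries (μ + 1))) := by
    intro μ
    rw [Derivation.leibniz, derivative_expSeries, derivative_besselSeries, smul_eq_mul,
      smul_eq_mul]
    ring
  -- The order stays universally quantified in the induction, since the recurrence refers to the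
  -- order μ+1.
  have hrec : ∀ (n : ℕ) (μ : ℂ),
      PowerSeries.coeff n (expSeries 2 * besselSeries μ) = kummerCoeff μ n := by
    intro n
    induction n using Nat.strong_induction_on with
    | _ n ih =>
      intro μ
      have h0 : PowerSeries.coeff 0 (expSeries 2 * besselSeries μ) = kummerCoeff μ 0 := by
        have := coeff_besselSeries_even μ 0
        rw [mul_zero] at this
        rw [PowerSeries.coeff_mul]
        simp [expSeries, this, kummerCoeff]
      match n, ih with
      | 0, _ => exact h0
      | 1, _ =>
        have h := congrArg (PowerSeries.coeff 0) (hd μ)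
        rw [PowerSeries.coeff_derivative, map_add, PowerSeries.coeff_C_mul,
          PowerSeries.coeff_C_mul, PowerSeries.coeff_zero_X_mul, h0] at h
        rw [kummerCoeff_one]
        simpa using h
      | n + 2, ih =>
        have h := congrArg (PowerSeries.coeff (n + 1)) (hd μ)
        rw [PowerSeries.coeff_derivative, map_add, PowerSeries.coeff_C_mul,
          PowerSeries.coeff_C_mul, PowerSeries.coeff_succ_X_mul, ih (n + 1) (by omega),
          ih n (by omega), ← kummerCoeff_add_two] at h
        have h3 : (n : ℂ) + 2 ≠ 0 := by exact_mod_cast (n + 1).succ_ne_zero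
        apply mul_left_cancel₀ h3
        rw [← h]
        push_cast
        ring
  ext n
  rw [hrec, PowerSeries.coeff_mk]

theorem summable_besselSeries (μ x : ℂ) :
    Summable fun n => ‖PowerSeries.coeff n (besselSeries μ) * x ^ n‖ := by
  obtain ⟨C, hC0, hC⟩ := exists_norm_inv_Gamma_le_of_point μ
  refine Summable.even_add_odd ?_ ?_
  · refine Summable.of_nonneg_of_le (fun _ => norm_nonneg _) (fun k => ?_)
      ((NormedSpace.norm_expSeries_div_summable (x ^ 2)).mul_left C)
    rw [coeff_besselSeries_even, pow_mul, mul_comm, ← mul_assoc, norm_mul, mul_comm,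
      div_eq_mul_inv]
    gcongr
    exact hC k
  · simp only [coeff_besselSeries_odd, zero_mul, norm_zero]
    exact summable_zero

theorem tsum_besselSeries (μ x : ℂ) : ∑' n, PowerSeries.coeff n (besselSeries μ) * x ^ n =
    ∑' k : ℕ, (x ^ 2) ^ k / ((k.factorial : ℂ) * Complex.Gamma (μ + k + 1)) := by
  have hs := (summable_besselSeries μ x).of_norm
  have he : ∀ k : ℕ, PowerSeries.coeff (2 * k) (besselSeries μ) * x ^ (2 * k) =
      (x ^ 2) ^ k / ((k.factorial : ℂ) * Complex.Gamma (μ + k + 1)) := fun k => by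
    rw [coeff_besselSeries_even, pow_mul, div_eq_mul_inv, mul_inv, mul_comm]
  have ho : ∀ k : ℕ, PowerSeries.coeff (2 * k + 1) (besselSeries μ) * x ^ (2 * k + 1) = 0 :=
    fun k => by rw [coeff_besselSeries_odd, zero_mul]
  have h2 : Function.Injective fun k : ℕ => 2 * k := fun a b h => by simpa using h
  have h := (hs.comp_injective h2).hasSum.even_add_odd
    (f := fun n => PowerSeries.coeff n (besselSeries μ) * x ^ n) (m' := 0)
    (by simp only [ho]; exact hasSum_zero)
  rw [h.tsum_eq, add_zero]
  exact tsum_congr he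

theorem summable_kummer (μ x : ℂ) : Summable fun k => ‖kummerCoeff μ k * x ^ k‖ := by
  have := (PowerSeries.hasSum_coeff_mul (summable_expSeries 2 x) (summable_besselSeries μ x)).1
  simpa only [expSeries_mul_besselSeries, PowerSeries.coeff_mk] using this

/-- Take x = -iz/2 in the formal identity: then x² = -(z/2)² and e^{iz} e^{2x} = 1. -/
theorem besselJ_eq_kummer (μ z : ℂ) : besselJ μ z =
    (z / 2) ^ μ * (Complex.exp (Complex.I * z) *
      ∑' k, kummerCoeff μ k * (-Complex.I * z / 2) ^ k) := by
  have h := (PowerSeries.hasSum_coeff_mul (summable_expSeries 2 (-Complex.I * z / 2))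
    (summable_besselSeries μ (-Complex.I * z / 2))).2
  simp only [expSeries_mul_besselSeries, PowerSeries.coeff_mk] at h
  rw [h, tsum_expSeries, tsum_besselSeries, ← mul_assoc (Complex.exp _), ← Complex.exp_add,
    show Complex.I * z + 2 * (-Complex.I * z / 2) = 0 by ring, Complex.exp_zero, one_mul,
    besselJ]
  congr 1
  refine tsum_congr fun k => ?_
  rw [show (-Complex.I * z / 2) ^ 2 = (-1) * (z / 2) ^ 2 by
    rw [div_pow, mul_pow, neg_sq, Complex.I_sq]; ring, mul_pow, pow_mul]

/-! ### Tricomi's incomplete gamma function -/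

theorem summable_gammaStar (ν w : ℂ) : Summable fun n => ‖PowerSeries.coeff n
    (PowerSeries.mk fun m : ℕ => (-1) ^ m / ((ν + m) * (m.factorial : ℂ))) * w ^ n‖ := by
  obtain ⟨R, hR⟩ := exists_nat_ge (‖ν‖ + 1)
  refine Summable.of_norm_bounded_eventually_nat
    (NormedSpace.norm_expSeries_div_summable w) ?_
  filter_upwards [eventually_ge_atTop R] with m hm
  have h1 : 1 ≤ ‖ν + m‖ := by
    have h2 : ‖(m : ℂ)‖ ≤ ‖ν + m‖ + ‖ν‖ := by
      have := norm_sub_le (ν + m) ν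
      rwa [show ν + m - ν = (m : ℂ) by ring] at this
    rw [Complex.norm_natCast] at h2
    have h4 : (R : ℝ) ≤ m := by exact_mod_cast hm
    linarith
  rw [norm_norm, PowerSeries.coeff_mk, norm_mul, norm_div, norm_mul, norm_div, norm_pow, norm_neg,
    norm_one, one_pow, div_mul_eq_mul_div, one_mul]
  exact div_le_div_of_nonneg_left (norm_nonneg _) (by
      rw [norm_pos_iff]; exact_mod_cast m.factorial_ne_zero)
    (le_mul_of_one_le_left (norm_nonneg _) h1)

/-- The series H on the left satisfies xH' + νH = e^{-x}. Hence K = e^x H satisfies xK' + νK = 1 +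
xK, which reads (ν+n+1) c_{n+1} = c_n with ν c_0 = 1. -/
theorem expSeries_mul_gammaStar {ν : ℂ} (hν : ∀ n : ℕ, ν ≠ -(n : ℂ)) :
    expSeries 1 * PowerSeries.mk (fun m : ℕ => (-1) ^ m / ((ν + m) * (m.factorial : ℂ))) =
      PowerSeries.mk fun m : ℕ => Complex.Gamma ν * (Complex.Gamma (ν + m + 1))⁻¹ := by
  set H : PowerSeries ℂ :=
    PowerSeries.mk (fun m : ℕ => (-1) ^ m / ((ν + m) * (m.factorial : ℂ))) with hH
  have hne : ∀ n : ℕ, ν + n ≠ 0 := fun n h => hν n (eq_neg_of_add_eq_zero_left h)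
  have hfac : ∀ n : ℕ, (n.factorial : ℂ) ≠ 0 := fun n => by exact_mod_cast n.factorial_ne_zero
  have hG : Complex.Gamma ν ≠ 0 := Complex.Gamma_ne_zero hν
  have hode : PowerSeries.X * PowerSeries.derivative ℂ H + PowerSeries.C ν * H =
      expSeries (-1) := by
    ext n
    rw [map_add, PowerSeries.coeff_C_mul]
    rcases n with _ | n
    · have := hne 0
      rw [Nat.cast_zero, add_zero] at this
      rw [PowerSeries.coeff_zero_X_mul]
      simp [hH, expSeries, this]
    · rw [PowerSeries.coeff_succ_X_mul, PowerSeries.coeff_derivative, hH, expSeries]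
      simp only [PowerSeries.coeff_mk]
      have := hne (n + 1)
      have := hfac (n + 1)
      push_cast at *
      field_simp
      ring
  have hexp : expSeries 1 * expSeries (-1) = 1 := by
    have h1 : ∀ n, PowerSeries.coeff (n + 1) (expSeries 1 * expSeries (-1)) = 0 := by
      intro n
      have hd : PowerSeries.derivative ℂ (expSeries 1 * expSeries (-1)) = 0 := by
        rw [Derivation.leibniz, derivative_expSeries, derivative_expSeries, smul_eq_mul,
          smul_eq_mul, map_neg, map_one]
        ring
      have := congrArg (PowerSeries.coeff n) hd
      rw [PowerSeries.coeff_derivative, map_zero] at this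
      exact (mul_eq_zero.1 this).resolve_right (by exact_mod_cast n.succ_ne_zero)
    ext n
    rcases n with _ | n
    · simp [PowerSeries.coeff_mul, expSeries]
    · rw [h1]; simp [PowerSeries.coeff_one]
  have hode2 : PowerSeries.X * PowerSeries.derivative ℂ (expSeries 1 * H) +
      PowerSeries.C ν * (expSeries 1 * H) = 1 + PowerSeries.X * (expSeries 1 * H) := by
    rw [Derivation.leibniz, derivative_expSeries, smul_eq_mul, smul_eq_mul, map_one]
    linear_combination expSeries 1 * hode + hexp
  ext n
  rw [PowerSeries.coeff_mk]
  induction n with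
  | zero =>
    have h := congrArg (PowerSeries.coeff 0) hode2
    rw [map_add, map_add, PowerSeries.coeff_C_mul, PowerSeries.coeff_zero_X_mul,
      PowerSeries.coeff_zero_X_mul, zero_add, add_zero, PowerSeries.coeff_zero_one] at h
    have h0 := hne 0
    rw [Nat.cast_zero, add_zero] at h0
    rw [Nat.cast_zero, add_zero, Complex.Gamma_add_one ν h0]
    field_simp
    rw [mul_comm]
    exact h
  | succ n ih =>
    have h := congrArg (PowerSeries.coeff (n + 1)) hode2
    rw [map_add, map_add, PowerSeries.coeff_C_mul, PowerSeries.coeff_succ_X_mul,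
      PowerSeries.coeff_succ_X_mul, PowerSeries.coeff_derivative, ih,
      Complex.one_div_Gamma_eq_self_mul_one_div_Gamma_add_one (ν + n + 1)] at h
    have h1 := hne (n + 1)
    push_cast at h1
    apply mul_left_cancel₀ h1
    rw [PowerSeries.coeff_one, if_neg n.succ_ne_zero] at h
    push_cast
    rw [show ν + (n + 1) + 1 = ν + n + 1 + 1 by ring]
    linear_combination h

/-- The everywhere convergent series for `e ^ w γ*(ν, w)`. -/
theorem hasSum_exp_mul_gammaStar {ν : ℂ} (hν : -(1 / 2) < ν.re) (w : ℂ) :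
    (Summable fun m : ℕ => ‖(Complex.Gamma (ν + m + 1))⁻¹ * w ^ m‖) ∧
      ∑' m : ℕ, (Complex.Gamma (ν + m + 1))⁻¹ * w ^ m = Complex.exp w * gammaStar ν w := by
  by_cases h : ∃ n : ℕ, ν = -(n : ℂ)
  · obtain ⟨n, rfl⟩ := h
    -- Of the exceptional values only ν = 0 lies in the half-plane; there γ* = 1 and the series is
    -- that of e^w.
    have hn : n = 0 := by
      by_contra hn
      have h1 : (1 : ℝ) ≤ n := by exact_mod_cast Nat.one_le_iff_ne_zero.2 hn
      simp at hν
      linarith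
    subst hn
    have hg : gammaStar (-((0 : ℕ) : ℂ)) w = 1 := by
      rw [gammaStar, if_pos ⟨0, rfl⟩]; simp
    have ht : ∀ m : ℕ, (Complex.Gamma (-((0 : ℕ) : ℂ) + m + 1))⁻¹ * w ^ m =
        w ^ m / (m.factorial : ℂ) := by
      intro m
      rw [Nat.cast_zero, neg_zero, zero_add, Complex.Gamma_nat_eq_factorial]
      ring
    simp only [ht, hg, mul_one]
    refine ⟨NormedSpace.norm_expSeries_div_summable w, ?_⟩
    rw [Complex.exp_eq_exp_ℂ]
    exact (NormedSpace.expSeries_div_hasSum_exp w).tsum_eq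
  · have hν' : ∀ n : ℕ, ν ≠ -(n : ℂ) := fun n hn => h ⟨n, hn⟩
    have hG : Complex.Gamma ν ≠ 0 := Complex.Gamma_ne_zero hν'
    obtain ⟨h1, h2⟩ := PowerSeries.hasSum_coeff_mul (summable_expSeries 1 w)
      (summable_gammaStar ν w)
    rw [expSeries_mul_gammaStar hν', tsum_expSeries, one_mul] at h2
    rw [expSeries_mul_gammaStar hν'] at h1
    simp only [PowerSeries.coeff_mk, mul_assoc (Complex.Gamma ν)] at h1 h2
    constructor
    · have h3 := h1.mul_left ‖(Complex.Gamma ν)⁻¹‖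
      refine h3.congr fun m => ?_
      rw [← norm_mul, inv_mul_cancel_left₀ hG]
    · rw [tsum_mul_left] at h2
      rw [gammaStar, if_neg h]
      apply mul_left_cancel₀ hG
      rw [h2, show Complex.Gamma ν * (Complex.exp w * ((Complex.Gamma ν)⁻¹ *
        ∑' m : ℕ, (-w) ^ m / ((ν + m) * (m.factorial : ℂ)))) = Complex.exp w *
        ∑' m : ℕ, (-w) ^ m / ((ν + m) * (m.factorial : ℂ)) by field_simp]
      congr 1
      refine tsum_congr fun m => ?_
      rw [neg_pow w]
      ring

/-! ### The Fourier coefficients of `(1 + e ^ (i θ)) ^ b` -/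

theorem two_cos_half_pos {θ : ℝ} (h1 : -Real.pi < θ) (h2 : θ < Real.pi) :
    0 < 2 * Real.cos (θ / 2) :=
  mul_pos two_pos (Real.cos_pos_of_mem_Ioo ⟨by linarith, by linarith⟩)

theorem intervalIntegrable_two_cos_half_cpow_pos {b : ℂ} (hb : -1 < b.re) :
    IntervalIntegrable (fun θ : ℝ => ((2 * Real.cos (θ / 2) : ℝ) : ℂ) ^ b)
      MeasureTheory.volume 0 Real.pi := by
  have hpi := Real.pi_pos
  set s := b.re with hs
  -- The majorant serves both signs of s: the constant bounds the function for s ≥ 0, and for s < 0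
  -- Jordan's inequality 2cos(θ/2) ≥ (2/π)(π-θ) gives the second summand.
  have h1 : IntervalIntegrable (fun θ : ℝ => (2 : ℝ) ^ s + (2 / Real.pi) ^ s * (Real.pi - θ) ^ s)
      MeasureTheory.volume 0 Real.pi := by
    refine (intervalIntegrable_const).add (IntervalIntegrable.const_mul ?_ _)
    have := (intervalIntegral.intervalIntegrable_rpow' (a := Real.pi) (b := 0) hb).comp_sub_left
      Real.pi
    simpa using this
  rw [intervalIntegrable_iff_integrableOn_Ioo_of_le hpi.le] at h1 ⊢
  refine MeasureTheory.Integrable.mono' h1 ?_ ?_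
  · exact (Measurable.pow_const (by fun_prop) b).aestronglyMeasurable
  · refine MeasureTheory.ae_restrict_of_forall_mem measurableSet_Ioo fun θ hθ => ?_
    have hx := two_cos_half_pos (by linarith [hθ.1]) hθ.2
    have hx2 : 2 * Real.cos (θ / 2) ≤ 2 := by linarith [Real.cos_le_one (θ / 2)]
    rw [Complex.norm_cpow_eq_rpow_re_of_pos hx, ← hs]
    have hy : 0 < Real.pi - θ := by linarith [hθ.2]
    have hyx : 2 / Real.pi * (Real.pi - θ) ≤ 2 * Real.cos (θ / 2) := by
      have := Real.mul_le_sin (x := (Real.pi - θ) / 2) (by linarith) (by linarith [hθ.1])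
      rw [show (Real.pi - θ) / 2 = Real.pi / 2 - θ / 2 by ring, Real.sin_pi_div_two_sub] at this
      calc 2 / Real.pi * (Real.pi - θ) = 2 * (2 / Real.pi * (Real.pi / 2 - θ / 2)) := by ring
        _ ≤ _ := by linarith
    rw [← Real.mul_rpow (by positivity) hy.le]
    rcases le_or_gt 0 s with h0 | h0
    · have := Real.rpow_le_rpow hx.le hx2 h0
      have : 0 ≤ (2 / Real.pi * (Real.pi - θ)) ^ s := by positivity
      linarith
    · have := Real.rpow_le_rpow_of_nonpos (by positivity) hyx h0.le
      have : 0 ≤ (2 : ℝ) ^ s := by positivity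
      linarith

theorem intervalIntegrable_two_cos_half_cpow {b : ℂ} (hb : -1 < b.re) :
    IntervalIntegrable (fun θ : ℝ => ((2 * Real.cos (θ / 2) : ℝ) : ℂ) ^ b)
      MeasureTheory.volume (-Real.pi) Real.pi := by
  have h := intervalIntegrable_two_cos_half_cpow_pos hb
  refine IntervalIntegrable.trans (b := 0) ?_ h
  have h2 := (h.comp_sub_left 0).symm
  simpa [neg_div] using h2

/-- On `(-π, π)` this is `(1 + e ^ (i θ)) ^ b e ^ (-i p θ)`. -/
def onePlusExpPow (b p : ℂ) (θ : ℝ) : ℂ :=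
  ((2 * Real.cos (θ / 2) : ℝ) : ℂ) ^ b * Complex.exp (Complex.I * (b / 2 - p) * θ)

theorem intervalIntegrable_onePlusExpPow {b : ℂ} (hb : -1 < b.re) (p : ℂ) :
    IntervalIntegrable (onePlusExpPow b p) MeasureTheory.volume (-Real.pi) Real.pi :=
  (intervalIntegrable_two_cos_half_cpow hb).mul_continuousOn
    (Continuous.continuousOn (by fun_prop))

/-- The Fourier coefficients of `(1 + e ^ (i θ)) ^ b`. -/
def onePlusExpCoeff (b p : ℂ) : ℂ := ∫ θ in (-Real.pi)..Real.pi, onePlusExpPow b p θ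

theorem exp_half_angle (θ : ℝ) : Complex.exp (Complex.I * (θ / 2)) =
    (Real.cos (θ / 2) : ℂ) + Real.sin (θ / 2) * Complex.I := by
  rw [mul_comm, Complex.exp_mul_I]
  push_cast
  ring

theorem exp_neg_half_angle (θ : ℝ) : Complex.exp (-(Complex.I * (θ / 2))) =
    (Real.cos (θ / 2) : ℂ) - Real.sin (θ / 2) * Complex.I := by
  have := exp_half_angle (-θ)
  push_cast at this
  rw [neg_div, mul_neg] at this
  rw [this, Complex.cos_neg, Complex.sin_neg]
  push_cast
  ring

/-- Multiply by 1 + e^{iθ}. This carries the value at p = 0 from Re b > 0 down to Re b > -1. -/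
theorem onePlusExpCoeff_add_one {b : ℂ} (hb : -1 < b.re) (p : ℂ) :
    onePlusExpCoeff (b + 1) p = onePlusExpCoeff b p + onePlusExpCoeff b (p - 1) := by
  unfold onePlusExpCoeff
  rw [← intervalIntegral.integral_add (intervalIntegrable_onePlusExpPow hb p)
    (intervalIntegrable_onePlusExpPow hb _)]
  refine intervalIntegral.integral_congr_Ioo_of_le (by linarith [Real.pi_pos]) fun θ hθ => ?_
  have hx := two_cos_half_pos hθ.1 hθ.2
  have hx' : ((2 * Real.cos (θ / 2) : ℝ) : ℂ) ≠ 0 := Complex.ofReal_ne_zero.2 hx.ne'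
  simp only [onePlusExpPow]
  rw [Complex.cpow_add _ _ hx', Complex.cpow_one,
    show Complex.I * (b / 2 - p) * θ =
      Complex.I * ((b + 1) / 2 - p) * θ + -(Complex.I * (θ / 2)) by ring,
    show Complex.I * (b / 2 - (p - 1)) * θ =
      Complex.I * ((b + 1) / 2 - p) * θ + Complex.I * (θ / 2) by ring,
    Complex.exp_add, Complex.exp_add, exp_half_angle, exp_neg_half_angle]
  push_cast
  ring

/-- Integrate the derivative of (1+e^{iθ})^{b+1} e^{-ipθ} over (-π, π); the boundary values vanish
because Re(b+1) > 0. -/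
theorem onePlusExpCoeff_rec {b : ℂ} (hb : -1 < b.re) (p : ℂ) :
    p * onePlusExpCoeff b p = (b + 1 - p) * onePlusExpCoeff b (p - 1) := by
  have hpi := Real.pi_pos
  have hb1 : b + 1 ≠ 0 := fun h => by
    have := congrArg Complex.re h
    simp at this
    linarith
  have hint : IntervalIntegrable (fun θ => Complex.I * ((b + 1 - p) * onePlusExpPow b (p - 1) θ -
      p * onePlusExpPow b p θ)) MeasureTheory.volume (-Real.pi) Real.pi :=
    (((intervalIntegrable_onePlusExpPow hb (p - 1)).const_mul _).sub
      ((intervalIntegrable_onePlusExpPow hb p).const_mul _)).const_mul _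
  have key := intervalIntegral.integral_eq_sub_of_hasDerivAt_of_le (a := -Real.pi) (b := Real.pi)
    (f := fun θ : ℝ => ((2 * Real.cos (θ / 2) : ℝ) : ℂ) ^ (b + 1) *
      Complex.exp (Complex.I * ((b + 1) / 2 - p) * θ))
    (by linarith) (by
      refine ContinuousOn.mul (Continuous.continuousOn ?_) (Continuous.continuousOn (by fun_prop))
      exact (Complex.continuous_ofReal_cpow_const (y := b + 1) (by simp; linarith)).comp
        (f := fun θ : ℝ => 2 * Real.cos (θ / 2)) (by fun_prop)) (fun θ hθ => by
      have hx := two_cos_half_pos hθ.1 hθ.2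
      have hx' : ((2 * Real.cos (θ / 2) : ℝ) : ℂ) ≠ 0 := Complex.ofReal_ne_zero.2 hx.ne'
      have d1 : HasDerivAt (fun θ : ℝ => 2 * Real.cos (θ / 2)) (-Real.sin (θ / 2)) θ := by
        have := ((Real.hasDerivAt_cos (θ / 2)).comp θ
          ((hasDerivAt_id θ).div_const 2)).const_mul 2
        refine this.congr_deriv ?_
        ring
      have d2 := (hasDerivAt_ofReal_cpow_const hx.ne' hb1).scomp θ d1
      have d3 : HasDerivAt (fun θ : ℝ => Complex.exp (Complex.I * ((b + 1) / 2 - p) * θ))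
          (Complex.exp (Complex.I * ((b + 1) / 2 - p) * θ) *
            (Complex.I * ((b + 1) / 2 - p))) θ := by
        have := (((hasDerivAt_id (θ : ℂ)).const_mul (Complex.I * ((b + 1) / 2 - p))).cexp).comp_ofReal
        simpa using this
      have d4 := d2.mul d3
      refine d4.congr_deriv ?_
      · simp only [onePlusExpPow, Function.comp_apply]
        rw [add_sub_cancel_right, Complex.cpow_add _ _ hx', Complex.cpow_one,
          show Complex.I * (b / 2 - p) * θ =
            Complex.I * ((b + 1) / 2 - p) * θ + -(Complex.I * (θ / 2)) by ring,
          show Complex.I * (b / 2 - (p - 1)) * θ =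
            Complex.I * ((b + 1) / 2 - p) * θ + Complex.I * (θ / 2) by ring,
          Complex.exp_add, Complex.exp_add, exp_half_angle, exp_neg_half_angle, Complex.real_smul]
        generalize Complex.exp (Complex.I * ((b + 1) / 2 - p) * θ) = e
        generalize ((2 * Real.cos (θ / 2) : ℝ) : ℂ) ^ b = x
        push_cast
        linear_combination -(b + 1) * x * e * Complex.sin (θ / 2) * Complex.I_sq) hint
  rw [intervalIntegral.integral_const_mul, intervalIntegral.integral_sub
    ((intervalIntegrable_onePlusExpPow hb (p - 1)).const_mul _)
    ((intervalIntegrable_onePlusExpPow hb p).const_mul _), intervalIntegral.integral_const_mul,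
    intervalIntegral.integral_const_mul, neg_div, Real.cos_neg, Real.cos_pi_div_two, mul_zero,
    Complex.ofReal_zero, Complex.zero_cpow hb1, zero_mul, zero_mul, sub_zero, mul_eq_zero] at key
  have := key.resolve_left Complex.I_ne_zero
  exact (sub_eq_zero.1 this).symm

theorem one_add_exp_cpow {θ : ℝ} (h1 : -Real.pi < θ) (h2 : θ < Real.pi) (b : ℂ) :
    (1 + Complex.exp (θ * Complex.I)) ^ b = onePlusExpPow b 0 θ := by
  have hx := two_cos_half_pos h1 h2
  have hx' : ((2 * Real.cos (θ / 2) : ℝ) : ℂ) ≠ 0 := Complex.ofReal_ne_zero.2 hx.ne'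
  have e1 : 1 + Complex.exp (θ * Complex.I) =
      ((2 * Real.cos (θ / 2) : ℝ) : ℂ) * Complex.exp (Complex.I * (θ / 2)) := by
    have h3 : Complex.exp (-(Complex.I * (θ / 2))) + Complex.exp (Complex.I * (θ / 2)) =
        ((2 * Real.cos (θ / 2) : ℝ) : ℂ) := by
      rw [exp_half_angle, exp_neg_half_angle]; push_cast; ring
    rw [← h3, add_mul, ← Complex.exp_add, ← Complex.exp_add, neg_add_cancel, Complex.exp_zero]
    congr 2
    ring
  have hlog : Complex.log (Complex.exp (Complex.I * (θ / 2))) = Complex.I * (θ / 2) := by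
    apply Complex.log_exp <;> simp <;> linarith
  rw [e1, Complex.cpow_def_of_ne_zero (mul_ne_zero hx' (Complex.exp_ne_zero _)),
    Complex.log_ofReal_mul hx (Complex.exp_ne_zero _), hlog, onePlusExpPow,
    Complex.cpow_def_of_ne_zero hx', ← Complex.exp_add, ← Complex.ofReal_log hx.le]
  congr 1
  ring

/-- The mean value property of (1+w)^b on the unit disc; Re b > 0 gives continuity up to the
boundary point w = -1. -/
theorem onePlusExpCoeff_zero_of_pos {b : ℂ} (hb : 0 < b.re) :
    onePlusExpCoeff b 0 = 2 * Real.pi := by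
  have hpi := Real.pi_pos
  have hb0 : b ≠ 0 := fun h => by simp [h] at hb
  have hav : Real.circleAverage (fun w : ℂ => (1 + w) ^ b) 0 1 = (1 + 0) ^ b := by
    refine circleAverage_of_differentiable_on_off_countable (s := ∅) Set.countable_empty ?_ ?_
    · intro w hw
      have hw1 : ‖w‖ ≤ 1 := by simpa using hw
      have hre := (abs_le.1 ((Complex.abs_re_le_norm w).trans hw1)).1
      have h := Complex.continuousAt_cpow_of_re_pos (p := (1 + w, b)) (Or.inl (by simp; linarith)) hb
      exact (ContinuousAt.comp (f := fun w : ℂ => (1 + w, b)) h (by fun_prop)).continuousWithinAt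
    · intro w hw
      have hw1 : ‖w‖ < 1 := by simpa using hw
      have hre := (abs_lt.1 ((Complex.abs_re_le_norm w).trans_lt hw1)).1
      refine DifferentiableAt.cpow_const (by fun_prop) ?_
      exact Or.inl (by simp; linarith)
  rw [Real.circleAverage_eq_integral_add (-Real.pi),
    intervalIntegral.integral_comp_add_right (fun θ =>
      (fun w : ℂ => (1 + w) ^ b) (circleMap 0 1 θ)) (-Real.pi), add_zero, Complex.one_cpow,
    zero_add, show 2 * Real.pi + -Real.pi = Real.pi by ring] at hav
  have hE : onePlusExpCoeff b 0 = ∫ θ in (-Real.pi)..Real.pi,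
      (fun w : ℂ => (1 + w) ^ b) (circleMap 0 1 θ) := by
    refine intervalIntegral.integral_congr_Ioo_of_le (by linarith) fun θ hθ => ?_
    rw [← one_add_exp_cpow hθ.1 hθ.2]
    simp [circleMap]
  rw [← hE, Complex.real_smul] at hav
  have hpi' : (Real.pi : ℂ) ≠ 0 := Complex.ofReal_ne_zero.2 hpi.ne'
  push_cast at hav
  field_simp at hav
  exact hav

/-- The recurrence at p = 0 kills the coefficient of index -1, and its factor b+1-p stays nonzero
for all smaller indices. -/
theorem onePlusExpCoeff_neg {b : ℂ} (hb : -1 < b.re) (n : ℕ) :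
    onePlusExpCoeff b (-(n : ℂ) - 1) = 0 := by
  induction n with
  | zero =>
    have h := onePlusExpCoeff_rec hb 0
    rw [zero_mul] at h
    rw [Nat.cast_zero, neg_zero]
    refine (mul_eq_zero.1 h.symm).resolve_left fun h => ?_
    have := congrArg Complex.re h
    simp at this
    linarith
  | succ n ih =>
    have h := onePlusExpCoeff_rec hb (-(n : ℂ) - 1)
    rw [ih, mul_zero] at h
    rw [show -((n + 1 : ℕ) : ℂ) - 1 = -(n : ℂ) - 1 - 1 by push_cast; ring]
    refine (mul_eq_zero.1 h.symm).resolve_left fun h => ?_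
    have := congrArg Complex.re h
    have hn : (0 : ℝ) ≤ n := n.cast_nonneg
    simp at this
    linarith

theorem onePlusExpCoeff_nat {b : ℂ} (hb : -1 < b.re) (n : ℕ) : onePlusExpCoeff b n =
    2 * Real.pi * ((∏ i ∈ Finset.range n, (b - i)) / (n.factorial : ℂ)) := by
  induction n with
  | zero =>
    have h1 := onePlusExpCoeff_add_one hb 0
    have h2 := onePlusExpCoeff_neg hb 0
    rw [Nat.cast_zero, neg_zero] at h2
    rw [h2, add_zero, onePlusExpCoeff_zero_of_pos (by simp; linarith)] at h1
    simp [← h1]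
  | succ n ih =>
    have h := onePlusExpCoeff_rec hb ((n + 1 : ℕ) : ℂ)
    have h1 : (n.factorial : ℂ) ≠ 0 := by exact_mod_cast n.factorial_ne_zero
    have h2 : (n : ℂ) + 1 ≠ 0 := by exact_mod_cast n.succ_ne_zero
    rw [show ((n + 1 : ℕ) : ℂ) - 1 = n by push_cast; ring, ih] at h
    rw [Nat.factorial_succ, Finset.prod_range_succ]
    push_cast at h ⊢
    apply mul_left_cancel₀ h2
    rw [h]
    field_simp
    ring

/-! ### Cauchy's cosine integral -/

theorem one_add_cos_cpow {θ : ℝ} (h1 : -Real.pi < θ) (h2 : θ < Real.pi) (a : ℂ) :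
    ((1 + Real.cos θ : ℝ) : ℂ) ^ a =
      (2 : ℂ) ^ (-a) * ((2 * Real.cos (θ / 2) : ℝ) : ℂ) ^ (2 * a) := by
  have hx := two_cos_half_pos h1 h2
  have hx' : ((2 * Real.cos (θ / 2) : ℝ) : ℂ) ≠ 0 := Complex.ofReal_ne_zero.2 hx.ne'
  have hc : 1 + Real.cos θ = 2⁻¹ * ((2 * Real.cos (θ / 2)) * (2 * Real.cos (θ / 2))) := by
    have := Real.cos_sq (θ / 2)
    rw [mul_div_cancel₀ _ (two_ne_zero' ℝ)] at this
    linarith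
  have h2 : ((2⁻¹ : ℝ) : ℂ) ^ a = (2 : ℂ) ^ (-a) := by
    rw [Complex.ofReal_inv, Complex.inv_cpow _ _ (by
      rw [Complex.arg_ofReal_of_nonneg two_pos.le]; exact Real.pi_pos.ne), Complex.cpow_neg]
    norm_num
  rw [hc, Complex.ofReal_mul, Complex.mul_cpow_ofReal_nonneg (by norm_num) (by positivity), h2,
    Complex.ofReal_mul, Complex.mul_cpow_ofReal_nonneg hx.le hx.le, two_mul a,
    Complex.cpow_add _ _ hx']

theorem intervalIntegrable_one_add_cos_cpow {a : ℂ} (ha : -(1 / 2) < a.re) :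
    IntervalIntegrable (fun θ : ℝ => ((1 + Real.cos θ : ℝ) : ℂ) ^ a)
      MeasureTheory.volume 0 Real.pi := by
  have h := (intervalIntegrable_two_cos_half_cpow_pos (b := 2 * a) (by simp; linarith)).const_mul
    ((2 : ℂ) ^ (-a))
  refine h.congr_uIoo fun θ hθ => ?_
  rw [Set.uIoo_of_le Real.pi_pos.le] at hθ
  exact (one_add_cos_cpow (by linarith [hθ.1, Real.pi_pos]) hθ.2 a).symm

/-- With 1 + cos θ = 2cos²(θ/2), the exponential in the Fourier integrand of index a-μ reduces to
e^{iμθ}; folding (-π, 0) onto (0, π) turns it into 2cos μθ. -/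
theorem integral_one_add_cos_cpow {a : ℂ} (ha : -(1 / 2) < a.re) (μ : ℂ) :
    ∫ θ in (0 : ℝ)..Real.pi, ((1 + Real.cos θ : ℝ) : ℂ) ^ a * Complex.cos (μ * θ) =
      (2 : ℂ) ^ (-a) / 2 * onePlusExpCoeff (2 * a) (a - μ) := by
  have hpi := Real.pi_pos
  have hint := intervalIntegrable_onePlusExpPow (b := 2 * a) (by simp; linarith) (a - μ)
  have i1 : IntervalIntegrable (onePlusExpPow (2 * a) (a - μ)) MeasureTheory.volume 0 Real.pi :=
    hint.mono_set (by
      rw [Set.uIcc_of_le hpi.le, Set.uIcc_of_le (by linarith)]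
      exact Set.Icc_subset_Icc (by linarith) le_rfl)
  have i2 : IntervalIntegrable (onePlusExpPow (2 * a) (a - μ)) MeasureTheory.volume (-Real.pi) 0 :=
    hint.mono_set (by
      rw [Set.uIcc_of_le (by linarith), Set.uIcc_of_le (by linarith)]
      exact Set.Icc_subset_Icc le_rfl (by linarith))
  have i3 : IntervalIntegrable (fun θ => onePlusExpPow (2 * a) (a - μ) (-θ))
      MeasureTheory.volume 0 Real.pi := by
    have := (i2.comp_sub_left 0).symm
    simpa using this
  have h0 : ∫ θ in (-Real.pi)..0, onePlusExpPow (2 * a) (a - μ) θ =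
      ∫ θ in (0 : ℝ)..Real.pi, onePlusExpPow (2 * a) (a - μ) (-θ) := by
    rw [intervalIntegral.integral_comp_neg (onePlusExpPow (2 * a) (a - μ)), neg_zero]
  rw [onePlusExpCoeff, ← intervalIntegral.integral_add_adjacent_intervals i2 i1, h0,
    ← intervalIntegral.integral_add i3 i1, ← intervalIntegral.integral_const_mul]
  refine intervalIntegral.integral_congr_Ioo_of_le hpi.le fun θ hθ => ?_
  simp only [onePlusExpPow]
  rw [one_add_cos_cpow (by linarith [hθ.1]) hθ.2, Complex.cos, neg_div, Real.cos_neg,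
    Complex.ofReal_neg,
    show Complex.I * (2 * a / 2 - (a - μ)) * -(θ : ℂ) = -(μ * θ) * Complex.I by ring,
    show Complex.I * (2 * a / 2 - (a - μ)) * (θ : ℂ) = μ * θ * Complex.I by ring]
  ring

/-! ### Expansion of the integral part -/

theorem HasSum.of_eq {f g : ℕ → ℂ} {a b : ℂ} (h : HasSum f a) (hfg : ∀ m, g m = f m)
    (hab : b = a) : HasSum g b := by
  rw [hab, funext hfg]
  exact h

/-- This is exactly the integrability threshold: (1+cos θ)^ν behaves like (π-θ)^{2ν} at θ = π. -/
theorem neg_half_lt_re_cfract (μ : ℂ) : -(1 / 2) < (cfract μ).re := by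
  have := Int.ceil_lt_add_one (μ.re - 1 / 2)
  simp only [cfract, nearestInt, Complex.sub_re, Complex.intCast_re]
  linarith

theorem cfract_add_nearestInt (μ : ℂ) : cfract μ + nearestInt μ.re = μ := by
  simp [cfract]

theorem one_add_cos_le_two (θ : ℝ) : |1 + Real.cos θ| ≤ 2 := by
  rw [abs_le]
  constructor <;> linarith [Real.cos_le_one θ, Real.neg_one_le_cos θ]

/-- The entire function `e ^ w γ*(ν, w)` at `w = -i z (1 + cos θ)`, as a series. -/
def expGammaStarCos (ν z : ℂ) (θ : ℝ) : ℂ :=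
  ∑' m : ℕ, (Complex.Gamma (ν + m + 1))⁻¹ * (-Complex.I * z * (1 + Real.cos θ : ℝ)) ^ m

theorem norm_expGammaStarCos_term_le (ν z : ℂ) (m : ℕ) (θ : ℝ) :
    ‖(Complex.Gamma (ν + m + 1))⁻¹ * (-Complex.I * z * (1 + Real.cos θ : ℝ)) ^ m‖ ≤
      ‖(Complex.Gamma (ν + m + 1))⁻¹ * (2 * z) ^ m‖ := by
  rw [norm_mul, norm_mul, norm_pow, norm_pow, norm_mul, norm_mul, norm_mul, norm_neg,
    Complex.norm_I, one_mul, Complex.norm_real, Real.norm_eq_abs, mul_comm ‖z‖, Complex.norm_two]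
  have := one_add_cos_le_two θ
  gcongr

theorem continuous_expGammaStarCos {ν : ℂ} (hν : -(1 / 2) < ν.re) (z : ℂ) :
    Continuous (expGammaStarCos ν z) :=
  continuous_tsum (fun m => by fun_prop) (hasSum_exp_mul_gammaStar hν (2 * z)).1
    (norm_expGammaStarCos_term_le ν z)

/-- Because -iz cos θ = iz + w with w = -iz(1+cos θ), the exponential supplies the factor e^w that
makes e^w γ*(ν,w) a simple series. -/
theorem exp_mul_incGammaP {ν : ℂ} (hν : -(1 / 2) < ν.re) (z : ℂ) (θ : ℝ) :
    Complex.exp (-Complex.I * z * Real.cos θ) * incGammaP ν z (1 + Real.cos θ) =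
      Complex.exp (Complex.I * z) *
        Complex.exp (ν * (Complex.log z - Complex.I * (Real.pi / 2))) *
        (((1 + Real.cos θ : ℝ) : ℂ) ^ ν * expGammaStarCos ν z θ) := by
  rw [expGammaStarCos, (hasSum_exp_mul_gammaStar hν _).2, incGammaP, negIPow,
    show -Complex.I * z * Real.cos θ =
      Complex.I * z + -Complex.I * z * (1 + Real.cos θ : ℝ) by push_cast; ring, Complex.exp_add]
  ring

theorem intervalIntegrable_exp_mul_incGammaP {ν : ℂ} (hν : -(1 / 2) < ν.re) (μ z : ℂ) :
    IntervalIntegrable (fun θ : ℝ => Complex.exp (-Complex.I * z * Real.cos θ) *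
      incGammaP ν z (1 + Real.cos θ) * Complex.cos (μ * θ)) MeasureTheory.volume 0 Real.pi := by
  simp only [exp_mul_incGammaP hν]
  have hc := continuous_expGammaStarCos hν z
  exact (((intervalIntegrable_one_add_cos_cpow hν).mul_continuousOn hc.continuousOn).const_mul
    _).mul_continuousOn (Continuous.continuousOn (by fun_prop))

theorem hasSum_integral_incGammaP {ν : ℂ} (hν : -(1 / 2) < ν.re) (μ z : ℂ) :
    HasSum (fun m : ℕ => Complex.exp (Complex.I * z) *
        Complex.exp (ν * (Complex.log z - Complex.I * (Real.pi / 2))) *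
        ((Complex.Gamma (ν + m + 1))⁻¹ * (-Complex.I * z) ^ m *
          ∫ θ in (0 : ℝ)..Real.pi, ((1 + Real.cos θ : ℝ) : ℂ) ^ (ν + m) * Complex.cos (μ * θ)))
      (∫ θ in (0 : ℝ)..Real.pi, Complex.exp (-Complex.I * z * Real.cos θ) *
        incGammaP ν z (1 + Real.cos θ) * Complex.cos (μ * θ)) := by
  have hg : IntervalIntegrable (fun θ : ℝ => ((1 + Real.cos θ : ℝ) : ℂ) ^ ν * Complex.cos (μ * θ))
      MeasureTheory.volume 0 Real.pi :=
    (intervalIntegrable_one_add_cos_cpow hν).mul_continuousOn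
      (Continuous.continuousOn (by fun_prop))
  have hsum := (hasSum_exp_mul_gammaStar hν (2 * z)).1
  have key := intervalIntegral.hasSum_integral_of_dominated_convergence
    (a := 0) (b := Real.pi) (μ := MeasureTheory.volume)
    (F := fun (m : ℕ) (θ : ℝ) => ((1 + Real.cos θ : ℝ) : ℂ) ^ ν * Complex.cos (μ * θ) *
      ((Complex.Gamma (ν + m + 1))⁻¹ * (-Complex.I * z * (1 + Real.cos θ : ℝ)) ^ m))
    (f := fun θ => ((1 + Real.cos θ : ℝ) : ℂ) ^ ν * Complex.cos (μ * θ) * expGammaStarCos ν z θ)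
    -- The majorant replaces |w| by its bound 2|z|.
    (fun m θ => ‖((1 + Real.cos θ : ℝ) : ℂ) ^ ν * Complex.cos (μ * θ)‖ *
      ‖(Complex.Gamma (ν + m + 1))⁻¹ * (2 * z) ^ m‖)
    (fun m => by
      refine (intervalIntegrable_iff.1 hg).aestronglyMeasurable.mul (Continuous.aestronglyMeasurable (by fun_prop)))
    (fun m => Eventually.of_forall fun θ _ => by
      rw [norm_mul]
      exact mul_le_mul_of_nonneg_left (norm_expGammaStarCos_term_le ν z m θ) (norm_nonneg _))
    (Eventually.of_forall fun θ _ => hsum.mul_left _)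
    (by simp only [tsum_mul_left]; exact hg.norm.mul_const _)
    (Eventually.of_forall fun θ _ => HasSum.mul_left _
      (Summable.of_norm_bounded hsum fun m => norm_expGammaStarCos_term_le ν z m θ).hasSum)
  have key2 := key.mul_left (Complex.exp (Complex.I * z) *
        Complex.exp (ν * (Complex.log z - Complex.I * (Real.pi / 2))))
  refine key2.of_eq (fun m => ?_) ?_
  · congr 1
    rw [← intervalIntegral.integral_const_mul]
    refine intervalIntegral.integral_congr_Ioo_of_le Real.pi_pos.le fun θ hθ => ?_
    have ht : 0 < 1 + Real.cos θ := by
      have h := Real.strictAntiOn_cos ⟨hθ.1.le, hθ.2.le⟩ ⟨Real.pi_pos.le, le_rfl⟩ hθ.2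
      rw [Real.cos_pi] at h
      linarith
    have ht' : ((1 + Real.cos θ : ℝ) : ℂ) ≠ 0 := Complex.ofReal_ne_zero.2 ht.ne'
    rw [Complex.cpow_add _ _ ht', Complex.cpow_natCast, mul_pow _ ((1 + Real.cos θ : ℝ) : ℂ)]
    ring
  · rw [← intervalIntegral.integral_const_mul]
    refine intervalIntegral.integral_congr fun θ _ => ?_
    rw [exp_mul_incGammaP hν]
    ring

/-- The terms of the Kummer series for `J_μ(z)` apart from the factor `i ^ μ e ^ (i z)`. -/
def besselTerm (z μ : ℂ) (k : ℕ) : ℂ := kummerCoeff μ k *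
  (Complex.exp ((μ + k) * (Complex.log z - Complex.I * (Real.pi / 2))) * 2 ^ (-(μ + k)))

theorem exp_log_sub {z : ℂ} (hz : z ≠ 0) :
    Complex.exp (Complex.log z - Complex.I * (Real.pi / 2)) = -Complex.I * z := by
  rw [Complex.exp_sub, Complex.exp_log hz, mul_comm Complex.I, Complex.exp_pi_div_two_mul_I,
    Complex.div_I]
  ring

theorem exp_nat_mul_log_sub {z : ℂ} (hz : z ≠ 0) (k : ℕ) :
    Complex.exp (k * (Complex.log z - Complex.I * (Real.pi / 2))) = (-Complex.I * z) ^ k := by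
  rw [Complex.exp_nat_mul, exp_log_sub hz]

theorem besselTerm_eq {z : ℂ} (hz : z ≠ 0) (μ : ℂ) (k : ℕ) : besselTerm z μ k =
    Complex.exp (μ * (Complex.log z - Complex.I * (Real.pi / 2))) * 2 ^ (-μ) *
      (kummerCoeff μ k * (-Complex.I * z / 2) ^ k) := by
  rw [besselTerm, add_mul, Complex.exp_add, exp_nat_mul_log_sub hz, neg_add,
    Complex.cpow_add _ _ two_ne_zero, Complex.cpow_neg 2 (k : ℂ), Complex.cpow_natCast, div_pow]
  ring

theorem summable_besselTerm {z : ℂ} (hz : z ≠ 0) (μ : ℂ) : Summable (besselTerm z μ) := by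
  have := (summable_kummer μ (-Complex.I * z / 2)).of_norm.mul_left
    (Complex.exp (μ * (Complex.log z - Complex.I * (Real.pi / 2))) * 2 ^ (-μ))
  exact this.congr fun k => (besselTerm_eq hz μ k).symm

theorem I_cpow (μ : ℂ) : Complex.I ^ μ = Complex.exp (μ * (Complex.I * (Real.pi / 2))) := by
  rw [Complex.cpow_def_of_ne_zero Complex.I_ne_zero, Complex.log_I]
  congr 1
  ring

theorem half_cpow {z : ℂ} (hz : z ≠ 0) (μ : ℂ) : (z / 2) ^ μ = Complex.I ^ μ *
    (Complex.exp (μ * (Complex.log z - Complex.I * (Real.pi / 2))) * 2 ^ (-μ)) := by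
  have h2 : Complex.log (z / 2) = Complex.log z - Complex.log 2 := by
    rw [show z / 2 = ((2⁻¹ : ℝ) : ℂ) * z by push_cast; ring,
      Complex.log_ofReal_mul (by norm_num) hz, Real.log_inv, Complex.ofReal_neg,
      Complex.ofReal_log two_pos.le]
    push_cast
    ring
  rw [I_cpow, Complex.cpow_def_of_ne_zero (div_ne_zero hz two_ne_zero),
    Complex.cpow_def_of_ne_zero two_ne_zero, h2, ← Complex.exp_add, ← Complex.exp_add]
  congr 1
  ring

theorem besselJ_eq_tsum {z : ℂ} (hz : z ≠ 0) (μ : ℂ) : besselJ μ z =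
    Complex.I ^ μ * Complex.exp (Complex.I * z) * ∑' k, besselTerm z μ k := by
  simp only [besselTerm_eq hz]
  rw [tsum_mul_left, besselJ_eq_kummer, half_cpow hz]
  ring

/-- The Fourier index (ν+m) - (ν+n) = m-n is an integer. When it is negative the coefficient is
zero; when it is k ≥ 0 the binomial numerator, read backwards, is the product in `kummerCoeff`. -/
theorem integral_term {z : ℂ} (hz : z ≠ 0) {ν : ℂ} (hν : -(1 / 2) < ν.re) (n : ℤ) (m : ℕ) :
    Complex.exp (ν * (Complex.log z - Complex.I * (Real.pi / 2))) *
        ((Complex.Gamma (ν + m + 1))⁻¹ * (-Complex.I * z) ^ m *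
          ∫ θ in (0 : ℝ)..Real.pi, ((1 + Real.cos θ : ℝ) : ℂ) ^ (ν + m) *
            Complex.cos ((ν + n) * θ)) =
      Real.pi * if n ≤ m then besselTerm z (ν + n) (m - n).toNat else 0 := by
  have ha : -(1 / 2) < (ν + m).re := by
    have : (0 : ℝ) ≤ m := m.cast_nonneg
    simp only [Complex.add_re, Complex.natCast_re]
    linarith
  have hb : -1 < (2 * (ν + m)).re := by
    simp only [Complex.mul_re, Complex.re_ofNat, Complex.im_ofNat, zero_mul, sub_zero]
    linarith
  rw [integral_one_add_cos_cpow ha, show ν + m - (ν + n) = (m : ℂ) - n by ring]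
  split_ifs with h
  · obtain ⟨k, hk⟩ := Int.le.dest h
    have hk' : (m : ℂ) = n + k := by exact_mod_cast hk.symm
    have hkn : ((m : ℤ) - n).toNat = k := by omega
    rw [hkn, show (m : ℂ) - n = (k : ℂ) by rw [hk']; ring, onePlusExpCoeff_nat hb, besselTerm,
      kummerCoeff, show ν + n + (k : ℂ) = ν + m by rw [hk']; ring, add_mul, Complex.exp_add,
      exp_nat_mul_log_sub hz, ← Finset.prod_range_reflect]
    have hprod : ∏ i ∈ Finset.range k, (2 * (ν + m) - ((k - 1 - i : ℕ) : ℂ)) =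
        ∏ i ∈ Finset.range k, (2 * (ν + n) + k + 1 + i) := by
      refine Finset.prod_congr rfl fun i hi => ?_
      have hi' := Finset.mem_range.1 hi
      have : ((k - 1 - i : ℕ) : ℂ) = k - 1 - i := by
        rw [Nat.cast_sub (by omega), Nat.cast_sub (by omega), Nat.cast_one]
      rw [this, hk']
      ring
    rw [hprod]
    ring
  · obtain ⟨k, hk⟩ := Int.le.dest (show (m : ℤ) + 1 ≤ n by omega)
    have hk' : (n : ℂ) = m + 1 + k := by exact_mod_cast hk.symm
    rw [show (m : ℂ) - n = -(k : ℂ) - 1 by rw [hk']; ring, onePlusExpCoeff_neg hb]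
    ring

theorem hasSum_integralB {z : ℂ} (hz : z ≠ 0) (μ : ℂ) :
    HasSum (fun m : ℕ => Complex.I ^ μ * Complex.exp (Complex.I * z) *
      if nearestInt μ.re ≤ m then besselTerm z μ (m - nearestInt μ.re).toNat else 0)
      (integralB μ z) := by
  have h := (hasSum_integral_incGammaP (neg_half_lt_re_cfract μ) μ z).mul_left
    (Complex.I ^ μ / Real.pi)
  have hpi : (Real.pi : ℂ) ≠ 0 := Complex.ofReal_ne_zero.2 Real.pi_ne_zero
  refine h.of_eq (fun m => ?_) rfl
  have ht := integral_term hz (neg_half_lt_re_cfract μ) (nearestInt μ.re) m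
  rw [cfract_add_nearestInt] at ht
  rw [mul_assoc (Complex.exp _), ht]
  field_simp

/-! ### The corrective sum -/

theorem Gamma_add_natCast {x : ℂ} (hx : ∀ i : ℕ, x + i ≠ 0) (n : ℕ) :
    Complex.Gamma (x + n) = (∏ i ∈ Finset.range n, (x + i)) * Complex.Gamma x := by
  induction n with
  | zero => simp
  | succ n ih =>
    rw [Nat.cast_succ, ← add_assoc, Complex.Gamma_add_one _ (hx n), ih, Finset.prod_range_succ]
    ring

/-- The zeros of sin 2πν are simple, hence isolated. Half-integers are excluded along with integers,
as the duplication argument requires. -/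
theorem eventually_two_mul_ne_int (μ : ℂ) : ∀ᶠ ν : ℂ in 𝓝[≠] μ, ∀ n : ℤ, 2 * ν ≠ n := by
  have hd : HasDerivAt (fun ν : ℂ => Complex.sin (2 * Real.pi * ν))
      (Complex.cos (2 * Real.pi * μ) * (2 * Real.pi)) μ := by
    simpa using ((hasDerivAt_id μ).const_mul (2 * Real.pi : ℂ)).csin
  have hs : ∀ᶠ ν in 𝓝[≠] μ, Complex.sin (2 * Real.pi * ν) ≠ 0 := by
    by_cases h : Complex.sin (2 * Real.pi * μ) = 0
    · refine hd.eventually_ne (mul_ne_zero (fun hc => ?_) ?_)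
      · have := Complex.sin_sq_add_cos_sq (2 * Real.pi * μ)
        rw [h, hc] at this
        norm_num at this
      · exact mul_ne_zero two_ne_zero (Complex.ofReal_ne_zero.2 Real.pi_ne_zero)
    · exact nhdsWithin_le_nhds (hd.continuousAt.eventually_ne h)
  filter_upwards [hs] with ν hν n hn
  apply hν
  rw [mul_right_comm, hn, Complex.sin_int_mul_pi]

theorem differentiable_kummerCoeff (k : ℕ) : Differentiable ℂ fun μ => kummerCoeff μ k := by
  unfold kummerCoeff
  refine Differentiable.mul ?_ ?_
  · refine Differentiable.div_const ?_ _
    exact Differentiable.fun_finsetProd fun i _ => by fun_prop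
  · exact Complex.differentiable_one_div_Gamma.comp (f := fun μ : ℂ => μ + k + 1) (by fun_prop)

theorem differentiable_besselTerm (z : ℂ) (k : ℕ) : Differentiable ℂ fun μ => besselTerm z μ k := by
  unfold besselTerm
  refine (differentiable_kummerCoeff k).mul (Differentiable.mul (by fun_prop) ?_)
  exact Differentiable.const_cpow (by fun_prop) (Or.inl two_ne_zero)

/-- Legendre's duplication formula gives this at nearby generic orders. The right side is entire in
the order, so the limit exists at every μ, the negative half-integers included. -/
theorem gammaRatio_succ (k : ℕ) (μ : ℂ) : gammaRatio (k + 1) μ =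
    Real.sqrt Real.pi * 2 ^ (-(2 * (μ + k))) * (k.factorial * kummerCoeff μ k) := by
  refine Tendsto.limUnder_eq ?_
  have hc : ContinuousAt (fun ν : ℂ => (Real.sqrt Real.pi : ℂ) * 2 ^ (-(2 * (ν + k))) *
      (k.factorial * kummerCoeff ν k)) μ := by
    have h1 := (differentiable_kummerCoeff k).continuous
    have h2 : Differentiable ℂ fun ν : ℂ => (2 : ℂ) ^ (-(2 * (ν + k))) :=
      Differentiable.const_cpow (by fun_prop) (Or.inl two_ne_zero)
    have h3 := h2.continuous
    fun_prop
  refine (hc.tendsto.mono_left nhdsWithin_le_nhds).congr' ?_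
  filter_upwards [eventually_two_mul_ne_int μ] with ν hν
  have h1 : ∀ i : ℕ, 2 * ν + k + 1 + i ≠ 0 := fun i h => hν (-(k + 1 + i)) (by
    push_cast; linear_combination h)
  have h2 := Complex.Gamma_mul_Gamma_add_half (ν + k + 1 / 2)
  rw [show 2 * (ν + k + 1 / 2) = 2 * ν + k + 1 + k by ring, Gamma_add_natCast h1,
    show ν + k + 1 / 2 + 1 / 2 = ν + k + 1 by ring,
    show 1 - (2 * ν + k + 1 + k) = -(2 * (ν + k)) by ring] at h2
  have g1 : Complex.Gamma (ν + k + 1) ≠ 0 := by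
    intro h
    obtain ⟨m, hm⟩ := (Complex.Gamma_eq_zero_iff _).1 h
    exact hν (-(2 * (m + k + 1))) (by push_cast; linear_combination 2 * hm)
  have g2 : Complex.Gamma (2 * ν + k + 1) ≠ 0 := by
    intro h
    obtain ⟨m, hm⟩ := (Complex.Gamma_eq_zero_iff _).1 h
    exact hν (-(m + k + 1)) (by push_cast; linear_combination hm)
  have hf : (k.factorial : ℂ) ≠ 0 := by exact_mod_cast k.factorial_ne_zero
  rw [kummerCoeff, show ((k + 1 : ℕ) : ℂ) + ν - 1 / 2 = ν + k + 1 / 2 by push_cast; ring,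
    show ((k + 1 : ℕ) : ℂ) + 2 * ν = 2 * ν + k + 1 by push_cast; ring, eq_div_iff g2]
  rw [← eq_div_iff g1] at h2
  rw [h2]
  field_simp

theorem corrective_eq {μ : ℂ} (hμ : μ.re ≤ -(1 / 2)) (z : ℂ) : corrective μ z =
    Complex.I ^ μ * Complex.exp (Complex.I * z) *
      ∑ k ∈ Finset.range (-nearestInt μ.re).toNat, besselTerm z μ k := by
  have hpi : (Real.sqrt Real.pi : ℂ) ≠ 0 :=
    Complex.ofReal_ne_zero.2 (Real.sqrt_ne_zero'.2 Real.pi_pos)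
  have hsum : ∀ N : ℕ, ∑ j ∈ Finset.Icc 1 N, gammaRatio j μ / Complex.Gamma j *
      negIPow z 2 (j + μ - 1) =
      Real.sqrt Real.pi * ∑ k ∈ Finset.range N, besselTerm z μ k := by
    intro N
    induction N with
    | zero => simp
    | succ k ih =>
      rw [Finset.sum_Icc_succ_top (by omega), ih, Finset.sum_range_succ, mul_add,
        gammaRatio_succ, Nat.cast_succ, Complex.Gamma_nat_eq_factorial, negIPow, besselTerm,
        show (k : ℂ) + 1 + μ - 1 = μ + k by ring,
        show -(2 * (μ + k)) = -(μ + k) + -(μ + k) by ring, Complex.cpow_add _ _ two_ne_zero,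
        Complex.ofReal_ofNat]
      have hf : (k.factorial : ℂ) ≠ 0 := by exact_mod_cast k.factorial_ne_zero
      have h2 : (2 : ℂ) ^ (-(μ + k)) * 2 ^ (μ + k) = 1 := by
        rw [← Complex.cpow_add _ _ two_ne_zero, neg_add_cancel, Complex.cpow_zero]
      generalize Complex.exp ((μ + k) * (Complex.log z - Complex.I * (Real.pi / 2))) = e
      field_simp
      linear_combination (kummerCoeff μ k * 2 ^ (-(μ + k)) * e) * h2
  rw [corrective, if_pos hμ, hsum]
  field_simp

theorem nearestInt_nonneg {x : ℝ} (hx : -(1 / 2) < x) : 0 ≤ nearestInt x := by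
  have : -1 < nearestInt x := Int.lt_ceil.2 (by push_cast; linarith)
  omega

theorem nearestInt_neg {x : ℝ} (hx : x ≤ -(1 / 2)) : nearestInt x ≤ -1 :=
  Int.ceil_le.2 (by push_cast; linarith)

/-- With n = ⟨Re μ⟩: for n ≥ 0 the first n terms of the expansion of B_μ vanish and the rest run
through the whole Kummer series; for n < 0 the expansion starts at k = -n and χ_μ supplies the
initial segment. -/
theorem besselJ_eq_integralB_add_corrective {z : ℂ} (hz : z ≠ 0) (μ : ℂ) :
    besselJ μ z = integralB μ z + corrective μ z := by
  have hB := (hasSum_integralB hz μ).tsum_eq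
  rw [tsum_mul_left] at hB
  have hT := summable_besselTerm hz μ
  rw [← hB, besselJ_eq_tsum hz]
  rcases lt_or_ge (-(1 / 2)) μ.re with h | h
  · rw [corrective, if_neg (not_le.2 h), add_zero]
    congr 1
    obtain ⟨N, hN⟩ := Int.eq_ofNat_of_zero_le (nearestInt_nonneg h)
    have hs := (hasSum_integralB hz μ).summable
    have hc : Complex.I ^ μ * Complex.exp (Complex.I * z) ≠ 0 := by
      rw [I_cpow]; exact mul_ne_zero (Complex.exp_ne_zero _) (Complex.exp_ne_zero _)
    rw [← ((summable_mul_left_iff hc).1 hs).sum_add_tsum_nat_add N, hN]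
    have h0 : ∑ m ∈ Finset.range N, (if ((N : ℤ)) ≤ (m : ℤ) then
        besselTerm z μ ((m : ℤ) - N).toNat else 0) = 0 :=
      Finset.sum_eq_zero fun m hm => if_neg (by have := Finset.mem_range.1 hm; omega)
    rw [h0, zero_add]
    refine tsum_congr fun k => ?_
    rw [if_pos (by push_cast; omega)]
    congr 1
    push_cast
    omega
  · rw [corrective_eq h, ← mul_add]
    congr 1
    have hn := nearestInt_neg h
    rw [← hT.sum_add_tsum_nat_add (-nearestInt μ.re).toNat, add_comm]
    congr 1
    refine tsum_congr fun k => ?_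
    rw [if_pos (by omega)]
    congr 1
    omega

/-! ### The integral part of `Y_μ(z)` -/

theorem I_cpow_neg (μ : ℂ) :
    Complex.I ^ (-μ) = Complex.I ^ μ * Complex.exp (-Complex.I * μ * Real.pi) := by
  rw [I_cpow, I_cpow, ← Complex.exp_add]
  congr 1
  ring

theorem intervalIntegrable_integrandB (μ z : ℂ) :
    IntervalIntegrable (integrandB μ z) MeasureTheory.volume 0 Real.pi :=
  intervalIntegrable_exp_mul_incGammaP (neg_half_lt_re_cfract μ) μ z

theorem integralY_eq_integral (μ z : ℂ) : integralY μ z =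
    Complex.I ^ μ / (Real.pi * Complex.sin (μ * Real.pi)) *
      ∫ θ in (0 : ℝ)..Real.pi, integrandY μ (cfract (-μ)) z θ := by
  have h : ∀ θ, integrandY μ (cfract (-μ)) z θ = Complex.cos (μ * Real.pi) * integrandB μ z θ -
      Complex.exp (-Complex.I * μ * Real.pi) * integrandB (-μ) z θ := by
    intro θ
    rw [integrandY, integrandB, integrandB, neg_mul μ, Complex.cos_neg]
    ring
  simp only [h]
  rw [intervalIntegral.integral_sub ((intervalIntegrable_integrandB μ z).const_mul _)
    ((intervalIntegrable_integrandB (-μ) z).const_mul _), intervalIntegral.integral_const_mul,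
    intervalIntegral.integral_const_mul, integralY, integralB, integralB, I_cpow_neg]
  ring

/-- Rounding to the nearest integer is odd except at ties, and Re {μ} = 1/2 is the tie. -/
theorem cfract_neg {μ : ℂ} (h : (cfract μ).re ≠ 1 / 2) : cfract (-μ) = -cfract μ := by
  have h1 := Int.le_ceil (μ.re - 1 / 2)
  have h2 := Int.ceil_lt_add_one (μ.re - 1 / 2)
  have h3 : μ.re - 1 / 2 ≠ ⌈μ.re - 1 / 2⌉ := by
    intro h3
    apply h
    simp only [cfract, nearestInt, Complex.sub_re, Complex.intCast_re]
    linarith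
  have h4 := lt_of_le_of_ne h1 h3
  have hn : nearestInt (-μ).re = -nearestInt μ.re := by
    rw [nearestInt, nearestInt, Int.ceil_eq_iff, Complex.neg_re]
    push_cast
    constructor <;> linarith
  rw [cfract, cfract, hn]
  push_cast
  ring

theorem besselY_of_not_int {μ : ℂ} (hμ : ∀ m : ℤ, μ ≠ m) (z : ℂ) :
    besselY μ z = besselYQuot μ z := by
  rw [besselY, if_neg fun ⟨m, hm⟩ => hμ m hm]

theorem corrective_of_re_nonneg {μ : ℂ} (hμ : 0 ≤ μ.re) (z : ℂ) : corrective μ z = 0 := by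
  rw [corrective, if_neg (by linarith)]

/-- Only the order among ±μ with negative real part can have a nonzero corrective sum, and that
order is -μ sgn(Re μ). Its coefficient in the numerator is cos μπ if it is μ, and -1 if it is -μ.
For Re μ = 0 both sums vanish, as does χ_0. -/
theorem besselYQuot_eq {z : ℂ} (hz : z ≠ 0) (μ : ℂ) : besselYQuot μ z = integralY μ z +
    factorS μ * corrective (-μ * (Real.sign μ.re : ℂ)) z / Complex.sin (μ * Real.pi) := by
  rw [besselYQuot, integralY, besselJ_eq_integralB_add_corrective hz,
    besselJ_eq_integralB_add_corrective hz]
  rcases lt_trichotomy μ.re 0 with h | h | h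
  · rw [factorS, if_pos h, Real.sign_of_neg h, corrective_of_re_nonneg (μ := -μ) (by
      rw [Complex.neg_re]; linarith)]
    rw [Complex.ofReal_neg, Complex.ofReal_one, neg_mul_neg, mul_one]
    ring
  · rw [corrective_of_re_nonneg h.ge, corrective_of_re_nonneg (μ := -μ) (by
      rw [Complex.neg_re]; linarith), h, Real.sign_zero, Complex.ofReal_zero, mul_zero,
      corrective_of_re_nonneg le_rfl]
    ring
  · rw [factorS, if_neg (not_lt.2 h.le), Real.sign_of_pos h, corrective_of_re_nonneg h.le,
      Complex.ofReal_one, mul_one]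
    ring

/-! ### Integer order -/

theorem differentiable_besselJ {z : ℂ} (hz : z ≠ 0) : Differentiable ℂ fun μ => besselJ μ z := by
  unfold besselJ
  refine Differentiable.mul (Differentiable.const_cpow differentiable_id
    (Or.inl (div_ne_zero hz two_ne_zero))) fun μ => ?_
  obtain ⟨R, hR⟩ := exists_nat_gt ‖μ‖
  obtain ⟨C, hC0, hC⟩ := exists_norm_inv_Gamma_le R
  have hmem : Metric.ball (0 : ℂ) R ∈ 𝓝 μ := Metric.isOpen_ball.mem_nhds (by simpa using hR)
  refine DifferentiableOn.differentiableAt (Complex.differentiableOn_tsum_of_summable_norm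
    ((NormedSpace.norm_expSeries_div_summable ((z / 2) ^ 2)).mul_left C) (fun k => ?_)
    Metric.isOpen_ball fun k w hw => ?_) hmem
  · have h : Differentiable ℂ fun μ : ℂ => (-1) ^ k * (z / 2) ^ (2 * k) *
        (((k.factorial : ℂ))⁻¹ * (Complex.Gamma (μ + k + 1))⁻¹) :=
      ((Complex.differentiable_one_div_Gamma.comp (f := fun μ : ℂ => μ + k + 1)
        (by fun_prop)).const_mul _).const_mul _
    simp only [div_eq_mul_inv _ ((k.factorial : ℂ) * _), mul_inv]
    exact h.differentiableOn
  · have hw' : ‖w‖ ≤ R := by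
      have : ‖w‖ < R := by simpa using hw
      exact this.le
    rw [pow_mul, norm_div, norm_mul, norm_mul, norm_pow, norm_neg, norm_one, one_pow, one_mul,
      ← div_div, ← norm_div, div_eq_mul_inv, mul_comm, ← norm_inv]
    gcongr
    exact hC w hw' k

theorem inv_Gamma_neg_nat (n : ℕ) : (Complex.Gamma (-(n : ℂ)))⁻¹ = 0 := by
  rw [Complex.Gamma_neg_nat_eq_zero, inv_zero]

theorem besselJ_neg_nat {z : ℂ} (hz : z ≠ 0) (n : ℕ) :
    besselJ (-(n : ℂ)) z = (-1) ^ n * besselJ n z := by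
  have hz2 : z / 2 ≠ 0 := div_ne_zero hz two_ne_zero
  set f : ℕ → ℂ := fun k => (-1) ^ k * (z / 2) ^ (2 * k) /
    ((k.factorial : ℂ) * Complex.Gamma (-(n : ℂ) + k + 1)) with hf
  -- The conventions Γ = 0 at the poles and division by zero equal to zero realise 1/Γ = 0 here.
  have h0 : ∀ k < n, f k = 0 := by
    intro k hk
    have : -(n : ℂ) + k + 1 = -((n - k - 1 : ℕ) : ℂ) := by
      rw [Nat.cast_sub (by omega), Nat.cast_sub (by omega), Nat.cast_one]
      ring
    rw [hf]
    simp only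
    rw [this, Complex.Gamma_neg_nat_eq_zero, mul_zero, div_zero]
  have hinj : Function.Injective fun k : ℕ => k + n := add_left_injective n
  have ht : ∑' k, f k = ∑' k, f (k + n) := by
    refine (hinj.tsum_eq fun k hk => ?_).symm
    by_contra hk'
    refine hk (h0 k ?_)
    by_contra hkn
    exact hk' ⟨k - n, by simp only; omega⟩
  rw [besselJ, besselJ, ht, Complex.cpow_neg, Complex.cpow_natCast]
  rw [← tsum_mul_left, ← tsum_mul_left, ← tsum_mul_left]
  refine tsum_congr fun k => ?_
  rw [hf]
  simp only
  rw [show -(n : ℂ) + ((k + n : ℕ) : ℂ) + 1 = k + 1 by push_cast; ring,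
    show (n : ℂ) + k + 1 = ((k + n : ℕ) : ℂ) + 1 by push_cast; ring,
    Complex.Gamma_nat_eq_factorial, Complex.Gamma_nat_eq_factorial]
  have hp : (z / 2) ^ n ≠ 0 := pow_ne_zero _ hz2
  rw [mul_add, pow_add, pow_add, two_mul n, pow_add _ n n]
  field_simp

theorem besselJ_neg_int {z : ℂ} (hz : z ≠ 0) (m : ℤ) :
    besselJ (-(m : ℂ)) z = (-1) ^ m * besselJ m z := by
  obtain ⟨n, rfl | rfl⟩ := m.eq_nat_or_neg
  · simpa using besselJ_neg_nat hz n
  · have h1 : ((-1 : ℂ)) ^ n * (-1) ^ n = 1 := by rw [← mul_pow]; simp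
    have h := besselJ_neg_nat hz n
    push_cast
    rw [neg_neg, h, zpow_neg, zpow_natCast, inv_mul_cancel_left₀ (pow_ne_zero _ (by norm_num))]

theorem Complex.cos_int_mul_pi (m : ℤ) : Complex.cos (m * Real.pi) = (-1) ^ m := by
  have := Complex.cos_antiperiodic.add_int_mul_eq (x := 0) m
  rwa [zero_add, Complex.cos_zero, mul_one, Int.cast_negOnePow] at this

/-- Both functions vanish at m, so their quotient is a quotient of difference quotients, and the
derivative (-1)^m π of the denominator is nonzero. -/
theorem exists_tendsto_div_sin {f : ℂ → ℂ} {m : ℤ} (hf : DifferentiableAt ℂ f m)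
    (h0 : f m = 0) :
    ∃ l, Tendsto (fun μ => f μ / Complex.sin (μ * Real.pi)) (𝓝[≠] (m : ℂ)) (𝓝 l) := by
  have hs : HasDerivAt (fun μ : ℂ => Complex.sin (μ * Real.pi)) ((-1) ^ m * Real.pi) m := by
    have := ((hasDerivAt_id (m : ℂ)).mul_const (Real.pi : ℂ)).csin
    simpa [Complex.cos_int_mul_pi] using this
  have hne : (-1 : ℂ) ^ m * Real.pi ≠ 0 :=
    mul_ne_zero (zpow_ne_zero _ (by norm_num)) (Complex.ofReal_ne_zero.2 Real.pi_ne_zero)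
  refine ⟨_, ((hasDerivAt_iff_tendsto_slope.1 hf.hasDerivAt).div
    (hasDerivAt_iff_tendsto_slope.1 hs) hne).congr' ?_⟩
  filter_upwards [self_mem_nhdsWithin] with μ hμ
  have hμ' : μ - m ≠ 0 := sub_ne_zero.2 hμ
  rw [Pi.div_apply, slope_def_field, slope_def_field, h0, Complex.sin_int_mul_pi, sub_zero,
    sub_zero, div_div_div_cancel_right₀ hμ']

theorem exists_tendsto_besselYQuot {z : ℂ} (hz : z ≠ 0) (m : ℤ) :
    ∃ l, Tendsto (fun μ => besselYQuot μ z) (𝓝[≠] (m : ℂ)) (𝓝 l) := by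
  have h := differentiable_besselJ hz
  refine exists_tendsto_div_sin (f := fun μ => besselJ μ z * Complex.cos (μ * Real.pi) -
    besselJ (-μ) z) ?_ ?_
  · have h2 : Differentiable ℂ fun μ => besselJ (-μ) z := h.comp differentiable_neg
    have h3 : Differentiable ℂ fun μ : ℂ => Complex.cos (μ * Real.pi) := by fun_prop
    exact ((h.mul h3).sub h2) _
  · rw [besselJ_neg_int hz, Complex.cos_int_mul_pi]
    ring

theorem eventually_ne_int (m : ℤ) : ∀ᶠ μ : ℂ in 𝓝[≠] (m : ℂ), ∀ n : ℤ, μ ≠ n := by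
  filter_upwards [eventually_two_mul_ne_int (m : ℂ)] with μ hμ n hn
  exact hμ (2 * n) (by rw [hn]; push_cast; ring)

theorem tendsto_besselY {z : ℂ} (hz : z ≠ 0) (m : ℤ) :
    Tendsto (fun μ => besselY μ z) (𝓝[≠] (m : ℂ)) (𝓝 (besselY m z)) := by
  obtain ⟨l, hl⟩ := exists_tendsto_besselYQuot hz m
  have h : besselY m z = l := by
    rw [besselY, if_pos ⟨m, rfl⟩]
    exact hl.limUnder_eq
  rw [h]
  refine hl.congr' ?_
  filter_upwards [eventually_ne_int m] with μ hμ
  exact (besselY_of_not_int hμ z).symm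

theorem besselTerm_neg_nat (z : ℂ) {n k : ℕ} (hk : k < n) : besselTerm z (-(n : ℂ)) k = 0 := by
  have : -(n : ℂ) + k + 1 = -((n - k - 1 : ℕ) : ℂ) := by
    rw [Nat.cast_sub (by omega), Nat.cast_sub (by omega), Nat.cast_one]
    ring
  rw [besselTerm, kummerCoeff, this, inv_Gamma_neg_nat]
  ring

/-- Near a negative integer the corrective sum is an entire function that vanishes there. -/
theorem exists_differentiable_eq_corrective (z : ℂ) {n : ℕ} (hn : 1 ≤ n) :
    ∃ F : ℂ → ℂ, Differentiable ℂ F ∧ F (-(n : ℂ)) = 0 ∧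
      ∀ μ : ℂ, |μ.re + n| < 1 / 4 → corrective μ z = F μ := by
  refine ⟨fun μ => Complex.I ^ μ * Complex.exp (Complex.I * z) *
    ∑ k ∈ Finset.range n, besselTerm z μ k, ?_, ?_, ?_⟩
  · refine Differentiable.mul (Differentiable.mul_const (Differentiable.const_cpow
      differentiable_id (Or.inl Complex.I_ne_zero)) _) ?_
    exact Differentiable.fun_sum fun k _ => differentiable_besselTerm z k
  · simp only
    rw [Finset.sum_eq_zero fun k hk => besselTerm_neg_nat z (Finset.mem_range.1 hk), mul_zero]
  · intro μ hμ
    rw [abs_lt] at hμ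
    have hn' : (1 : ℝ) ≤ n := by exact_mod_cast hn
    -- Within 1/4 of -n the rounding is constant, so the number of summands in χ_μ does not change.
    have h : nearestInt μ.re = -(n : ℤ) := by
      rw [nearestInt, Int.ceil_eq_iff]
      push_cast
      constructor <;> linarith [hμ.1, hμ.2]
    rw [corrective_eq (by linarith [hμ.2]), h, neg_neg, Int.toNat_natCast]

theorem exists_tendsto_corrective (z : ℂ) (m : ℤ) :
    ∃ C, Tendsto (fun μ => factorS μ * corrective (-μ * (Real.sign μ.re : ℂ)) z /
      Complex.sin (μ * Real.pi)) (𝓝[≠] (m : ℂ)) (𝓝 C) := by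
  have hball : ∀ᶠ μ : ℂ in 𝓝[≠] (m : ℂ), |μ.re - m| < 1 / 4 := by
    refine nhdsWithin_le_nhds ?_
    filter_upwards [Metric.ball_mem_nhds (m : ℂ) (by norm_num : (0 : ℝ) < 1 / 4)] with μ hμ
    rw [Metric.mem_ball, dist_eq_norm] at hμ
    simpa using (Complex.abs_re_le_norm (μ - m)).trans_lt hμ
  rcases lt_trichotomy m 0 with hm | rfl | hm
  · obtain ⟨n, hn⟩ := Int.eq_ofNat_of_zero_le (show 0 ≤ -m by omega)
    obtain rfl : m = -(n : ℤ) := by omega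
    obtain ⟨F, hF, hF0, hFc⟩ := exists_differentiable_eq_corrective z (n := n) (by omega)
    have hn1 : (1 : ℝ) ≤ n := by exact_mod_cast (show 1 ≤ n by omega)
    obtain ⟨l, hl⟩ := exists_tendsto_div_sin (m := -(n : ℤ))
      (f := fun μ => Complex.cos (μ * Real.pi) * F μ)
      (DifferentiableAt.mul (by fun_prop) (hF _)) (by push_cast; rw [hF0, mul_zero])
    refine ⟨l, hl.congr' ?_⟩
    filter_upwards [hball] with μ hμ
    push_cast at hμ
    rw [sub_neg_eq_add] at hμ
    have hre : μ.re < 0 := by linarith [(abs_lt.1 hμ).2]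
    rw [factorS, if_pos hre, Real.sign_of_neg hre, Complex.ofReal_neg, Complex.ofReal_one,
      neg_mul_neg, mul_one, hFc μ hμ]
  · refine ⟨0, tendsto_const_nhds.congr' ?_⟩
    filter_upwards [hball] with μ hμ
    rw [Int.cast_zero, sub_zero, abs_lt] at hμ
    -- Whatever the sign, the order has real part above -1/4, where the corrective sum is empty by
    -- definition.
    have : corrective (-μ * (Real.sign μ.re : ℂ)) z = 0 := by
      rw [corrective, if_neg]
      rw [Complex.re_mul_ofReal, Complex.neg_re, not_le]
      rcases Real.sign_apply_eq μ.re with h | h | h <;> rw [h] <;> linarith [hμ.1, hμ.2]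
    rw [this]
    simp
  · obtain ⟨n, rfl⟩ := Int.eq_ofNat_of_zero_le hm.le
    obtain ⟨F, hF, hF0, hFc⟩ := exists_differentiable_eq_corrective z (n := n) (by omega)
    have hn1 : (1 : ℝ) ≤ n := by exact_mod_cast (show 1 ≤ n by omega)
    obtain ⟨l, hl⟩ := exists_tendsto_div_sin (m := (n : ℤ)) (f := fun μ => -1 * F (-μ))
      (((hF.comp differentiable_neg).const_mul _) _) (by
        simp only [Int.cast_natCast]; rw [hF0, mul_zero])
    refine ⟨l, hl.congr' ?_⟩
    filter_upwards [hball] with μ hμ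
    rw [Int.cast_natCast] at hμ
    have hre : 0 < μ.re := by linarith [(abs_lt.1 hμ).1]
    rw [factorS, if_neg hre.not_gt, Real.sign_of_pos hre, Complex.ofReal_one, mul_one,
      hFc (-μ) (by rwa [Complex.neg_re, ← abs_neg, neg_add, neg_neg, ← sub_eq_add_neg])]

end

/-! ### The representation of `Y_μ(z)` and its limits at integer order -/

theorem mainTheorem3 (z : ℂ) (hz : z ∈ Complex.slitPlane) :
    (∀ μ : ℂ, IntervalIntegrable (integrandB μ z) MeasureTheory.volume 0 Real.pi) ∧
    (∀ μ : ℂ, (∀ m : ℤ, μ ≠ m) →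
      besselY μ z = integralY μ z +
        factorS μ * corrective (-μ * (Real.sign μ.re : ℂ)) z / Complex.sin (μ * Real.pi) ∧
      integralY μ z = Complex.I ^ μ / (Real.pi * Complex.sin (μ * Real.pi)) *
        ∫ θ in (0 : ℝ)..Real.pi, integrandY μ (cfract (-μ)) z θ) ∧
    (∀ μ : ℂ, (∀ m : ℤ, μ ≠ m) → (cfract μ).re ≠ 1 / 2 →
      integralY μ z = Complex.I ^ μ / (Real.pi * Complex.sin (μ * Real.pi)) *
        ∫ θ in (0 : ℝ)..Real.pi, integrandY μ (-cfract μ) z θ) ∧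
    (∀ m : ℤ, ∃ A C : ℂ,
      Filter.Tendsto (fun μ => integralY μ z) (nhdsWithin (m : ℂ) {(m : ℂ)}ᶜ) (nhds A) ∧
      Filter.Tendsto (fun μ => factorS μ * corrective (-μ * (Real.sign μ.re : ℂ)) z /
        Complex.sin (μ * Real.pi)) (nhdsWithin (m : ℂ) {(m : ℂ)}ᶜ) (nhds C) ∧
      Filter.Tendsto (fun μ => besselY μ z) (nhdsWithin (m : ℂ) {(m : ℂ)}ᶜ)
        (nhds (besselY m z)) ∧
      besselY m z = A + C) := by
  have hz0 := Complex.slitPlane_ne_zero hz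
  refine ⟨fun μ => intervalIntegrable_integrandB μ z, fun μ hμ => ⟨?_, integralY_eq_integral μ z⟩,
    fun μ _ h => ?_, fun m => ?_⟩
  · rw [besselY_of_not_int hμ, besselYQuot_eq hz0]
  · rw [← cfract_neg h]
    exact integralY_eq_integral μ z
  · obtain ⟨C, hC⟩ := exists_tendsto_corrective z m
    have hY := tendsto_besselY hz0 m
    -- The limit of 𝒴_μ is found as a difference, which avoids any continuity of the integrals B_μ
    -- in the order.
    refine ⟨besselY m z - C, C, (hY.sub hC).congr' ?_, hC, hY, (sub_add_cancel _ _).symm⟩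
    filter_upwards [eventually_ne_int m] with μ hμ
    rw [besselY_of_not_int hμ, besselYQuot_eq hz0, add_sub_cancel_right]
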